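/- Let $\phi$ be an Orlicz function, i.e. $\phi:[0,\infty)\to[0,\infty)$ is convex, non-decreasing, $\phi(0)=0$, $\phi(t)>0$ for $t>0$, $\lim_{t\to\infty}\phi(t)=\infty$, extended to $\mathbf R$ by $\phi(-t)=\phi(t)$. Let $\ell_\phi$ be the Orlicz space of all real sequences $x=(x_n)_n$ with $\sum_n\phi(x_n/\rho)<\infty$ for some $\rho>0$, normed by $\|x\|_\phi=\inf\{\rho>0:\sum_n\phi(x_n/\rho)\le 1\}$. Let $\theta:\mathbf R\to\mathbf R$ be a Lipschitz map, put $$F(y)_n=y_n\,\theta\Bigl(\log\frac{\|y\|_\phi}{|y_n|}\Bigr)\ \text{ if } y_n\ne0,\qquad F(y)_n=0\ \text{ if } y_n=0,$$ and let the twisted sum $\ell_\phi\oplus_F\ell_\phi$ be the space of all pairs of real sequences $(x,y)$ with $y\in\ell_\phi$ and $x-F(y)\in\ell_\phi$, with the quasi-norm $\|(x,y)\|=\|y\|_\phi+\|x-F(y)\|_\phi$. Suppose that $\ell_\phi$ has non-trivial type, i.e. (Rademacher) type $p$ for some $p\in(1,2]$. Then $c_{00}\times c_{00}$ (the pairs of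 finitely supported sequences) is contained and dense in $\ell_\phi\oplus_F\ell_\phi$, and there is a norm on $\ell_\phi\oplus_F\ell_\phi$, equivalent to the quasi-norm, under which it is a Banach space with property (M); in particular $\ell_\phi\oplus_F\ell_\phi$ is the completion of $c_{00}\times c_{00}$ in the quasi-norm. Here a Banach space $X$ has property (M) if $$\limsup_{n\to\infty}\|u+x_n\|=\limsup_{n\to\infty}\|v+x_n\|$$ whenever $u,v\in X$, $\|u\|=\|v\|$ and $(x_n)_n$ is a weakly null sequence in $X$. In particular, the same conclusion holds for the Kalton–Peck spaces $Z_p$, $1<p<\infty$, which are the twisted sums obtained for $\phi(t)=|t|^p$ and $\theta(t)=t$; hence $Z_2$ has property (M) after renorming. -/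

import Mathlib

open Filter Topology
open scoped NNReal

noncomputable section

/-- A finite valued, non-degenerate Orlicz function: convex and non-decreasing on `[0, ∞)`,
vanishing exactly at `0`, tending to `∞`, and extended to the real line as an even function. -/
structure OrliczFunction where
  toFun : ℝ → ℝ
  convexOn' : ConvexOn ℝ (Set.Ici 0) toFun
  monotoneOn' : MonotoneOn toFun (Set.Ici 0)
  map_zero' : toFun 0 = 0
  pos' : ∀ t : ℝ, 0 < t → 0 < toFun t
  tendsto' : Tendsto toFun atTop atTop
  even' : ∀ t : ℝ, toFun (-t) = toFun t

namespace OrliczFunction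

instance : CoeFun OrliczFunction (fun _ => ℝ → ℝ) := ⟨OrliczFunction.toFun⟩

variable (φ : OrliczFunction)

theorem apply_abs (t : ℝ) : φ |t| = φ t := by
  rcases abs_choice t with h | h <;> rw [h]
  exact φ.even' t

theorem mono_abs {s t : ℝ} (h : |s| ≤ |t|) : φ s ≤ φ t := by
  rw [← φ.apply_abs s, ← φ.apply_abs t]
  exact φ.monotoneOn' (abs_nonneg s) (abs_nonneg t) h

theorem nonneg (t : ℝ) : 0 ≤ φ t := by
  rw [← φ.map_zero']
  exact φ.mono_abs (by simp)

theorem convex_comb {a b : ℝ} (ha : 0 ≤ a) (hb : 0 ≤ b) (hab : a + b = 1) (s t : ℝ) :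
    φ (a * s + b * t) ≤ a * φ s + b * φ t := by
  have h1 : φ (a * s + b * t) ≤ φ (a * |s| + b * |t|) := by
    apply φ.mono_abs
    rw [abs_of_nonneg (a := a * |s| + b * |t|) (by positivity)]
    calc |a * s + b * t| ≤ |a * s| + |b * t| := abs_add_le _ _
      _ = a * |s| + b * |t| := by rw [abs_mul, abs_mul, abs_of_nonneg ha, abs_of_nonneg hb]
  have h2 := φ.convexOn'.2 (abs_nonneg s) (abs_nonneg t) ha hb hab
  simp only [smul_eq_mul, φ.apply_abs] at h2
  exact h1.trans h2

theorem mul_le {a : ℝ} (ha : 0 ≤ a) (ha1 : a ≤ 1) (s : ℝ) : φ (a * s) ≤ a * φ s := by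
  have h := φ.convex_comb ha (sub_nonneg.2 ha1) (by ring) s 0
  simpa [φ.map_zero'] using h

/-- The admissible radii in the definition of the Luxemburg norm: all `ρ > 0` with
`∑ φ (xₙ / ρ) ≤ 1`, the series being convergent. -/
def radii (x : ℕ → ℝ) : Set ℝ :=
  {ρ | 0 < ρ ∧ Summable (fun n => φ (x n / ρ)) ∧ ∑' n, φ (x n / ρ) ≤ 1}

/-- The Luxemburg norm `‖x‖_φ = inf {ρ > 0 : ∑ φ (xₙ / ρ) ≤ 1}`. -/
def luxNorm (x : ℕ → ℝ) : ℝ := sInf (φ.radii x)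

/-- Membership in `ℓ_φ`: the modular `∑ φ (xₙ / ρ)` is finite for some `ρ > 0`. -/
def Mem (x : ℕ → ℝ) : Prop := ∃ ρ : ℝ, 0 < ρ ∧ Summable (fun n => φ (x n / ρ))

variable {φ}

theorem radii_bddBelow (x : ℕ → ℝ) : BddBelow (φ.radii x) := ⟨0, fun _ h => h.1.le⟩

theorem luxNorm_nonneg (x : ℕ → ℝ) : 0 ≤ φ.luxNorm x := Real.sInf_nonneg fun _ h => h.1.le

theorem radii_nonempty {x : ℕ → ℝ} (hx : φ.Mem x) : (φ.radii x).Nonempty := by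
  obtain ⟨ρ, hρ, hs⟩ := hx
  set A := max 1 (∑' n, φ (x n / ρ)) with hA
  have hA1 : 1 ≤ A := le_max_left _ _
  have hA0 : 0 < A := by linarith
  have hle : ∀ n, φ (x n / (A * ρ)) ≤ A⁻¹ * φ (x n / ρ) := fun n => by
    have h := φ.mul_le (inv_nonneg.2 hA0.le) (inv_le_one_of_one_le₀ hA1) (x n / ρ)
    have e : x n / (A * ρ) = A⁻¹ * (x n / ρ) := by field_simp
    rwa [e]
  have hs' : Summable (fun n => φ (x n / (A * ρ))) :=
    Summable.of_nonneg_of_le (fun n => φ.nonneg _) hle (hs.mul_left _)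
  refine ⟨A * ρ, by positivity, hs', ?_⟩
  calc ∑' n, φ (x n / (A * ρ)) ≤ ∑' n, A⁻¹ * φ (x n / ρ) :=
        hs'.tsum_le_tsum hle (hs.mul_left _)
    _ = A⁻¹ * ∑' n, φ (x n / ρ) := tsum_mul_left
    _ ≤ A⁻¹ * A := by gcongr; exact le_max_right _ _
    _ = 1 := inv_mul_cancel₀ hA0.ne'

theorem mem_of_radii {x : ℕ → ℝ} {ρ : ℝ} (h : ρ ∈ φ.radii x) : φ.Mem x := ⟨ρ, h.1, h.2.1⟩

theorem radii_add {x y : ℕ → ℝ} {ρ σ : ℝ} (hx : ρ ∈ φ.radii x) (hy : σ ∈ φ.radii y) :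
    ρ + σ ∈ φ.radii (x + y) := by
  obtain ⟨hρ, hs, hs1⟩ := hx
  obtain ⟨hσ, ht, ht1⟩ := hy
  have hp : 0 < ρ + σ := by positivity
  have hab : ρ / (ρ + σ) + σ / (ρ + σ) = 1 := by field_simp
  have hle : ∀ n, φ ((x + y) n / (ρ + σ)) ≤
      ρ / (ρ + σ) * φ (x n / ρ) + σ / (ρ + σ) * φ (y n / σ) := fun n => by
    have h := φ.convex_comb (a := ρ / (ρ + σ)) (b := σ / (ρ + σ)) (by positivity) (by positivity)
      hab (x n / ρ) (y n / σ)
    have e : (x + y) n / (ρ + σ) = ρ / (ρ + σ) * (x n / ρ) + σ / (ρ + σ) * (y n / σ) := by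
      simp only [Pi.add_apply]; field_simp
    rwa [e]
  have hr := (hs.mul_left (ρ / (ρ + σ))).add (ht.mul_left (σ / (ρ + σ)))
  have hs' : Summable (fun n => φ ((x + y) n / (ρ + σ))) :=
    Summable.of_nonneg_of_le (fun n => φ.nonneg _) hle hr
  refine ⟨hp, hs', (hs'.tsum_le_tsum hle hr).trans ?_⟩
  rw [(hs.mul_left (ρ / (ρ + σ))).tsum_add (ht.mul_left (σ / (ρ + σ))), tsum_mul_left,
    tsum_mul_left, ← hab]
  have h1 : 0 ≤ ρ / (ρ + σ) := by positivity
  have h2 : 0 ≤ σ / (ρ + σ) := by positivity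
  nlinarith

theorem radii_smul {x : ℕ → ℝ} {c ρ : ℝ} (hc : c ≠ 0) (hx : ρ ∈ φ.radii x) :
    |c| * ρ ∈ φ.radii (c • x) := by
  obtain ⟨hρ, hs, hs1⟩ := hx
  have e : ∀ n, φ ((c • x) n / (|c| * ρ)) = φ (x n / ρ) := fun n => by
    rw [← φ.apply_abs, ← φ.apply_abs (x n / ρ)]
    congr 1
    simp only [Pi.smul_apply, smul_eq_mul, abs_div, abs_mul, abs_abs]
    have : |c| ≠ 0 := abs_ne_zero.2 hc
    field_simp
  refine ⟨by positivity, ?_, ?_⟩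
  · simpa only [e] using hs
  · simpa only [e] using hs1

theorem mem_zero : φ.Mem 0 := ⟨1, one_pos, by simp [φ.map_zero', summable_zero]⟩

theorem mem_add {x y : ℕ → ℝ} (hx : φ.Mem x) (hy : φ.Mem y) : φ.Mem (x + y) := by
  obtain ⟨ρ, hρ⟩ := radii_nonempty hx
  obtain ⟨σ, hσ⟩ := radii_nonempty hy
  exact mem_of_radii (radii_add hρ hσ)

theorem mem_smul (c : ℝ) {x : ℕ → ℝ} (hx : φ.Mem x) : φ.Mem (c • x) := by
  rcases eq_or_ne c 0 with rfl | hc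
  · simpa using mem_zero
  · obtain ⟨ρ, hρ⟩ := radii_nonempty hx
    exact mem_of_radii (radii_smul hc hρ)

theorem mem_of_abs_le {x y : ℕ → ℝ} (hy : φ.Mem y) (h : ∀ n, |x n| ≤ |y n|) : φ.Mem x := by
  obtain ⟨ρ, hρ, hs⟩ := hy
  refine ⟨ρ, hρ, Summable.of_nonneg_of_le (fun n => φ.nonneg _) (fun n => φ.mono_abs ?_) hs⟩
  rw [abs_div, abs_div]
  exact div_le_div_of_nonneg_right (h n) (abs_nonneg _)

theorem luxNorm_zero : φ.luxNorm 0 = 0 := by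
  refine le_antisymm (le_of_forall_pos_le_add fun ε hε => ?_) (luxNorm_nonneg _)
  rw [zero_add]
  exact csInf_le (radii_bddBelow _) ⟨hε, by simp [φ.map_zero', summable_zero],
    by simp [φ.map_zero']⟩

theorem luxNorm_add_le {x y : ℕ → ℝ} (hx : φ.Mem x) (hy : φ.Mem y) :
    φ.luxNorm (x + y) ≤ φ.luxNorm x + φ.luxNorm y := by
  refine le_of_forall_pos_le_add fun ε hε => ?_
  obtain ⟨ρ, hρ, h1⟩ := exists_lt_of_csInf_lt (radii_nonempty hx)
    (show sInf (φ.radii x) < φ.luxNorm x + ε / 2 by unfold luxNorm; linarith)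
  obtain ⟨σ, hσ, h2⟩ := exists_lt_of_csInf_lt (radii_nonempty hy)
    (show sInf (φ.radii y) < φ.luxNorm y + ε / 2 by unfold luxNorm; linarith)
  have := csInf_le (radii_bddBelow _) (radii_add hρ hσ)
  change φ.luxNorm (x + y) ≤ _ at this
  linarith

theorem luxNorm_smul_le {x : ℕ → ℝ} {c : ℝ} (hc : c ≠ 0) (hx : φ.Mem x) :
    φ.luxNorm (c • x) ≤ |c| * φ.luxNorm x := by
  have hc' : 0 < |c| := abs_pos.2 hc
  rw [← div_le_iff₀' hc']
  refine le_csInf (radii_nonempty hx) fun ρ hρ => ?_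
  rw [div_le_iff₀' hc']
  exact csInf_le (radii_bddBelow _) (radii_smul hc hρ)

theorem luxNorm_smul (c : ℝ) {x : ℕ → ℝ} (hx : φ.Mem x) :
    φ.luxNorm (c • x) = |c| * φ.luxNorm x := by
  rcases eq_or_ne c 0 with rfl | hc
  · simp [luxNorm_zero]
  refine le_antisymm (luxNorm_smul_le hc hx) ?_
  have h := luxNorm_smul_le (inv_ne_zero hc) (mem_smul c hx)
  rw [smul_smul, inv_mul_cancel₀ hc, one_smul, abs_inv] at h
  have hc' : 0 < |c| := abs_pos.2 hc
  calc |c| * φ.luxNorm x ≤ |c| * (|c|⁻¹ * φ.luxNorm (c • x)) := by gcongr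
    _ = φ.luxNorm (c • x) := by field_simp

theorem luxNorm_pos {x : ℕ → ℝ} (hx : φ.Mem x) {n : ℕ} (hn : x n ≠ 0) : 0 < φ.luxNorm x := by
  obtain ⟨R, hR⟩ := eventually_atTop.1 (φ.tendsto'.eventually_gt_atTop 1)
  set R' := max R 1
  have hR' : 0 < R' := lt_of_lt_of_le one_pos (le_max_right _ _)
  refine lt_of_lt_of_le (show 0 < |x n| / R' by have := abs_pos.2 hn; positivity) ?_
  refine le_csInf (radii_nonempty hx) fun ρ ⟨hρ, hs, hs1⟩ => ?_
  have h1 : φ |x n / ρ| ≤ 1 := by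
    rw [φ.apply_abs]
    exact (hs.le_tsum n fun m _ => φ.nonneg _).trans hs1
  have h2 : |x n / ρ| < R' := by
    by_contra! h
    exact absurd (hR _ ((le_max_left _ _).trans h)) (not_lt.2 h1)
  rw [abs_div, abs_of_pos hρ, div_lt_iff₀ hρ] at h2
  rw [div_le_iff₀' hR']
  exact h2.le

variable (φ)

/-- The Orlicz sequence space `ℓ_φ` as a space of real sequences. -/
def seqSubmodule : Submodule ℝ (ℕ → ℝ) where
  carrier := {x | φ.Mem x}
  zero_mem' := mem_zero
  add_mem' := mem_add
  smul_mem' c _ hx := mem_smul c hx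

end OrliczFunction

/-- The Orlicz sequence space `ℓ_φ`, normed by the Luxemburg norm. -/
def OrliczSpace (φ : OrliczFunction) : Type := φ.seqSubmodule

namespace OrliczSpace

variable (φ : OrliczFunction)

instance : AddCommGroup (OrliczSpace φ) := inferInstanceAs (AddCommGroup φ.seqSubmodule)
instance : Module ℝ (OrliczSpace φ) := inferInstanceAs (Module ℝ φ.seqSubmodule)
instance : Norm (OrliczSpace φ) := ⟨fun x => φ.luxNorm x.1⟩

theorem normCore : NormedSpace.Core ℝ (OrliczSpace φ) where
  norm_nonneg x := OrliczFunction.luxNorm_nonneg x.1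
  norm_smul c x := OrliczFunction.luxNorm_smul c x.2
  norm_triangle x y := OrliczFunction.luxNorm_add_le x.2 y.2
  norm_eq_zero_iff x := by
    constructor
    · intro h
      by_contra hx
      have : ∃ n, x.1 n ≠ 0 := by
        by_contra! hn
        exact hx (Subtype.ext (funext hn))
      obtain ⟨n, hn⟩ := this
      exact (OrliczFunction.luxNorm_pos x.2 hn).ne' h
    · rintro rfl
      exact OrliczFunction.luxNorm_zero

instance : NormedAddCommGroup (OrliczSpace φ) := NormedAddCommGroup.ofCore (normCore φ)
instance : NormedSpace ℝ (OrliczSpace φ) := NormedSpace.ofCore (normCore φ)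

end OrliczSpace

/-- `E` has (Rademacher) type `p`: for some constant `T`, the average of `‖∑ εᵢ xᵢ‖` over all
choices of signs is at most `T (∑ ‖xᵢ‖ ^ p) ^ (1 / p)`, for all finite families in `E`. -/
def HasType (E : Type*) [NormedAddCommGroup E] [NormedSpace ℝ E] (p : ℝ) : Prop :=
  ∃ T : ℝ, ∀ (n : ℕ) (x : Fin n → E),
    (∑ ε : Fin n → ℤˣ, ‖∑ i, ((ε i : ℤ) : ℝ) • x i‖) / 2 ^ n ≤
      T * (∑ i, ‖x i‖ ^ p) ^ (1 / p)

/-- `E` has non-trivial type: it has type `p` for some `p ∈ (1, 2]`. -/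
def HasNontrivialType (E : Type*) [NormedAddCommGroup E] [NormedSpace ℝ E] : Prop :=
  ∃ p : ℝ, 1 < p ∧ p ≤ 2 ∧ HasType E p

/-- Property (M). -/
def PropertyM (X : Type*) [NormedAddCommGroup X] [NormedSpace ℝ X] : Prop :=
  ∀ (u v : X) (x : ℕ → X), ‖u‖ = ‖v‖ →
    (∀ f : X →L[ℝ] ℝ, Tendsto (fun n => f (x n)) atTop (𝓝 0)) →
    limsup (fun n => ‖u + x n‖) atTop = limsup (fun n => ‖v + x n‖) atTop

/-- The map `F (y)ₙ = yₙ θ (log (‖y‖_φ / |yₙ|))`; the `n`-th term is `0` when `yₙ = 0`. -/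
def quasiLinearF (φ : OrliczFunction) (θ : ℝ → ℝ) (y : ℕ → ℝ) : ℕ → ℝ :=
  fun n => y n * θ (Real.log (φ.luxNorm y / |y n|))

/-- The quasi-norm `‖(x, y)‖ = ‖y‖_φ + ‖x - F y‖_φ`. -/
def twistedQuasiNorm (φ : OrliczFunction) (θ : ℝ → ℝ) (z : (ℕ → ℝ) × (ℕ → ℝ)) : ℝ :=
  φ.luxNorm z.2 + φ.luxNorm (z.1 - quasiLinearF φ θ z.2)

section QuasiAdditive

variable {θ : ℝ → ℝ} {K : ℝ≥0}

theorem lip_abs (hθ : LipschitzWith K θ) (a b : ℝ) : |θ a - θ b| ≤ K * |a - b| := by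
  simpa [Real.dist_eq] using hθ.dist_le_mul a b

theorem mul_log_ratio_le {s u : ℝ} (hs : 0 < s) (hsu : s ≤ u) :
    s * |(-Real.log s) - (-Real.log u)| ≤ u := by
  have hu : 0 < u := hs.trans_le hsu
  have h1 : Real.log s ≤ Real.log u := Real.log_le_log hs hsu
  rw [abs_of_nonneg (by linarith)]
  have h2 : Real.log (u / s) ≤ u / s - 1 := Real.log_le_sub_one_of_pos (by positivity)
  rw [Real.log_div hu.ne' hs.ne'] at h2
  have h3 : s * (-Real.log s - -Real.log u) ≤ s * (u / s - 1) :=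
    mul_le_mul_of_nonneg_left (by linarith) hs.le
  have h4 : s * (u / s - 1) = u - s := by field_simp
  linarith

theorem omega_quasi_pos (hθ : LipschitzWith K θ) {s t : ℝ} (hs : 0 < s) (ht : 0 < t) :
    |s * θ (-Real.log s) + t * θ (-Real.log t) - (s + t) * θ (-Real.log (s + t))| ≤
      2 * K * (s + t) := by
  have key : ∀ r, 0 < r → r ≤ s + t →
      |r * (θ (-Real.log r) - θ (-Real.log (s + t)))| ≤ K * (s + t) := fun r hr hle => by
    rw [abs_mul, abs_of_pos hr]
    calc r * |θ (-Real.log r) - θ (-Real.log (s + t))|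
        ≤ r * (K * |(-Real.log r) - (-Real.log (s + t))|) := by gcongr; exact lip_abs hθ _ _
      _ = K * (r * |(-Real.log r) - (-Real.log (s + t))|) := by ring
      _ ≤ K * (s + t) := by gcongr; exact mul_log_ratio_le hr hle
  have e : s * θ (-Real.log s) + t * θ (-Real.log t) - (s + t) * θ (-Real.log (s + t)) =
      s * (θ (-Real.log s) - θ (-Real.log (s + t))) +
      t * (θ (-Real.log t) - θ (-Real.log (s + t))) := by ring
  rw [e]
  have h1 := key s hs (by linarith)
  have h2 := key t ht (by linarith)
  exact (abs_add_le _ _).trans (by linarith)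

theorem omega_quasi (hθ : LipschitzWith K θ) (s t : ℝ) :
    |s * θ (-Real.log |s|) + t * θ (-Real.log |t|) - (s + t) * θ (-Real.log |s + t|)| ≤
      2 * K * (|s| + |t|) := by
  simp only [Real.log_abs]
  have hK : (0 : ℝ) ≤ K := K.2
  -- it suffices to bound the symmetric expression in `a + b + c = 0`
  have main : ∀ a b : ℝ, 0 ≤ a → 0 ≤ b →
      |a * θ (-Real.log a) + b * θ (-Real.log b) - (a + b) * θ (-Real.log (a + b))| ≤
        2 * K * (a + b) := fun a b ha hb => by
    rcases ha.eq_or_lt with rfl | ha'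
    · simp; positivity
    rcases hb.eq_or_lt with rfl | hb'
    · simp; positivity
    exact omega_quasi_pos hθ ha' hb'
  have opp : ∀ a b : ℝ, 0 ≤ a → b ≤ 0 →
      |a * θ (-Real.log a) + b * θ (-Real.log b) - (a + b) * θ (-Real.log (a + b))| ≤
        2 * K * (|a| + |b|) := fun a b ha hb => by
    rw [abs_of_nonneg ha, abs_of_nonpos hb]
    rcases le_total 0 (a + b) with h | h
    · have := main (a + b) (-b) h (by linarith)
      rw [Real.log_neg_eq_log, show a + b + -b = a by ring] at this
      rw [abs_sub_comm] at this
      have e : a * θ (-Real.log a) + b * θ (-Real.log b) - (a + b) * θ (-Real.log (a + b)) =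
        a * θ (-Real.log a) - ((a + b) * θ (-Real.log (a + b)) + -b * θ (-Real.log b)) := by ring
      rw [e]
      have : 0 ≤ 2 * K * (-b) := by have : 0 ≤ -b := by linarith
                                    positivity
      linarith
    · have := main a (-(a + b)) ha (by linarith)
      rw [Real.log_neg_eq_log, show a + -(a + b) = -b by ring, Real.log_neg_eq_log] at this
      have e : a * θ (-Real.log a) + b * θ (-Real.log b) - (a + b) * θ (-Real.log (a + b)) =
        a * θ (-Real.log a) + -(a + b) * θ (-Real.log (a + b)) - -b * θ (-Real.log b) := by ring
      rw [e]
      have : 0 ≤ 2 * K * a := by positivity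
      linarith
  rcases le_total 0 s with hs | hs <;> rcases le_total 0 t with ht | ht
  · rw [abs_of_nonneg hs, abs_of_nonneg ht]; exact main s t hs ht
  · exact opp s t hs ht
  · have := opp t s ht hs
    rw [add_comm t s, add_comm |t| |s|] at this
    rwa [add_comm (s * _) (t * _)]
  · have := main (-s) (-t) (by linarith) (by linarith)
    rw [show -s + -t = -(s + t) by ring] at this
    simp only [Real.log_neg_eq_log] at this
    rw [abs_of_nonpos hs, abs_of_nonpos ht, show -s + -t = -(s + t) by ring, ← abs_neg]
    convert this using 2
    ring

theorem omega_scale (hθ : LipschitzWith K θ) {a : ℝ} (ha : 0 < a) (s : ℝ) :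
    |s * θ (Real.log (a / |s|)) - s * θ (-Real.log |s|)| ≤ K * |Real.log a| * |s| := by
  rcases eq_or_ne s 0 with rfl | hs
  · simp
  rw [Real.log_div ha.ne' (abs_ne_zero.2 hs), ← mul_sub, abs_mul]
  have h := lip_abs hθ (Real.log a - Real.log |s|) (-Real.log |s|)
  rw [show Real.log a - Real.log |s| - -Real.log |s| = Real.log a by ring] at h
  calc |s| * _ ≤ |s| * (K * |Real.log a|) := by gcongr
    _ = _ := by ring

variable {φ : OrliczFunction}

/-- With `y ∈ ℓ_φ` fixed, `F y` differs from the map with `‖y‖_φ` replaced by `1` by a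
multiple of `|y|`. -/
theorem quasiLinearF_sub_le (hθ : LipschitzWith K θ) {y : ℕ → ℝ} (hy : φ.Mem y) (n : ℕ) :
    |quasiLinearF φ θ y n - y n * θ (-Real.log |y n|)| ≤
      K * |Real.log (φ.luxNorm y)| * |y n| := by
  rcases eq_or_ne (y n) 0 with h | h
  · simp [quasiLinearF, h]
  · exact omega_scale hθ (OrliczFunction.luxNorm_pos hy h) (y n)

theorem quasiLinearF_add_mem (hθ : LipschitzWith K θ) {y y' : ℕ → ℝ} (hy : φ.Mem y)
    (hy' : φ.Mem y') :
    φ.Mem (quasiLinearF φ θ y + quasiLinearF φ θ y' - quasiLinearF φ θ (y + y')) := by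
  have habs : ∀ {w : ℕ → ℝ}, φ.Mem w → φ.Mem (fun n => |w n|) := fun hw =>
    OrliczFunction.mem_of_abs_le hw fun n => by simp
  set C : ℝ := K * |Real.log (φ.luxNorm y)| with hC
  set C' : ℝ := K * |Real.log (φ.luxNorm y')| with hC'
  set D : ℝ := K * |Real.log (φ.luxNorm (y + y'))| with hD
  have hD0 : 0 ≤ D := by positivity
  have hmem : φ.Mem ((2 * K + C + C' + D) • ((fun n => |y n|) + fun n => |y' n|)) :=
    OrliczFunction.mem_smul _ (OrliczFunction.mem_add (habs hy) (habs hy'))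
  refine OrliczFunction.mem_of_abs_le hmem fun n => ?_
  have h1 := quasiLinearF_sub_le hθ hy n
  have h2 := quasiLinearF_sub_le hθ hy' n
  have h3 := quasiLinearF_sub_le hθ (OrliczFunction.mem_add hy hy') n
  have h4 := omega_quasi hθ (y n) (y' n)
  rw [← hC] at h1
  rw [← hC'] at h2
  rw [← hD] at h3
  simp only [Pi.add_apply, Pi.sub_apply, Pi.smul_apply, smul_eq_mul] at *
  refine le_trans ?_ (le_abs_self _)
  have h5 : D * |y n + y' n| ≤ D * (|y n| + |y' n|) := by
    gcongr; exact abs_add_le _ _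
  have hCn : 0 ≤ C * |y' n| := by positivity
  have hCn' : 0 ≤ C' * |y n| := by positivity
  rw [abs_le] at h1 h2 h3 h4 ⊢
  constructor <;> nlinarith

theorem quasiLinearF_smul (c : ℝ) {y : ℕ → ℝ} (hy : φ.Mem y) :
    quasiLinearF φ θ (c • y) = c • quasiLinearF φ θ y := by
  rcases eq_or_ne c 0 with rfl | hc
  · funext n; simp [quasiLinearF]
  funext n
  have : |c| ≠ 0 := abs_ne_zero.2 hc
  simp only [quasiLinearF, OrliczFunction.luxNorm_smul c hy, Pi.smul_apply, smul_eq_mul, abs_mul,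
    mul_div_mul_left _ _ this, mul_assoc]

end QuasiAdditive

/-- The twisted sum `ℓ_φ ⊕_F ℓ_φ`: all pairs of sequences `(x, y)` of finite quasi-norm, that is,
with `y ∈ ℓ_φ` and `x - F y ∈ ℓ_φ`. -/
def twistedSum (φ : OrliczFunction) {θ : ℝ → ℝ} {K : ℝ≥0} (hθ : LipschitzWith K θ) :
    Submodule ℝ ((ℕ → ℝ) × (ℕ → ℝ)) where
  carrier := {z | φ.Mem z.2 ∧ φ.Mem (z.1 - quasiLinearF φ θ z.2)}
  zero_mem' := by
    have : quasiLinearF φ θ 0 = 0 := by funext n; simp [quasiLinearF]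
    refine ⟨OrliczFunction.mem_zero, ?_⟩
    simpa [this] using OrliczFunction.mem_zero (φ := φ)
  add_mem' := by
    rintro z w ⟨hz, hz'⟩ ⟨hw, hw'⟩
    refine ⟨OrliczFunction.mem_add hz hw, ?_⟩
    have h := OrliczFunction.mem_add (OrliczFunction.mem_add hz' hw') (quasiLinearF_add_mem hθ hz hw)
    convert h using 1
    simp only [Prod.fst_add, Prod.snd_add]
    abel
  smul_mem' := by
    rintro c z ⟨hz, hz'⟩
    refine ⟨OrliczFunction.mem_smul c hz, ?_⟩
    have h := OrliczFunction.mem_smul c hz'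
    rw [smul_sub, ← quasiLinearF_smul c hz] at h
    exact h

/-- The twisted sum contains `c₀₀ × c₀₀` as a dense subset, so that (when it is complete) it is
the completion of `c₀₀ × c₀₀` in the quasi-norm. -/
def FiniteSupportDense (φ : OrliczFunction) {θ : ℝ → ℝ} {K : ℝ≥0} (hθ : LipschitzWith K θ) :
    Prop :=
  (∀ w : (ℕ → ℝ) × (ℕ → ℝ), w.1.support.Finite → w.2.support.Finite → w ∈ twistedSum φ hθ) ∧
  ∀ z ∈ twistedSum φ hθ, ∀ δ : ℝ, 0 < δ → ∃ w ∈ twistedSum φ hθ,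
    w.1.support.Finite ∧ w.2.support.Finite ∧ twistedQuasiNorm φ θ (z - w) < δ

/-- The twisted sum can be equivalently renormed to be a Banach space with property (M): it is
linearly isomorphic to a Banach space with property (M) whose norm, carried over by the
isomorphism, is equivalent to the quasi-norm. -/
def RenormablePropertyM (φ : OrliczFunction) {θ : ℝ → ℝ} {K : ℝ≥0} (hθ : LipschitzWith K θ) :
    Prop :=
  ∃ (E : Type) (_ : NormedAddCommGroup E) (_ : NormedSpace ℝ E) (e : E ≃ₗ[ℝ] twistedSum φ hθ),
    CompleteSpace E ∧
    (∃ c C : ℝ, 0 < c ∧ 0 < C ∧ ∀ v : E,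
      c * twistedQuasiNorm φ θ (e v) ≤ ‖v‖ ∧ ‖v‖ ≤ C * twistedQuasiNorm φ θ (e v)) ∧
    PropertyM E

/-- The Orlicz function `|t| ^ p`, whose Orlicz space is `ℓ_p`. -/
def powOrlicz (p : ℝ) (hp : 1 < p) : OrliczFunction where
  toFun t := |t| ^ p
  convexOn' := (convexOn_rpow hp.le).congr fun t ht => by
    simp only [abs_of_nonneg (show (0 : ℝ) ≤ t from ht)]
  monotoneOn' := fun s hs t ht h => by
    simp only [abs_of_nonneg (show (0 : ℝ) ≤ s from hs), abs_of_nonneg (show (0 : ℝ) ≤ t from ht)]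
    exact Real.rpow_le_rpow hs h (by linarith)
  map_zero' := by simp [Real.zero_rpow (show p ≠ 0 by linarith)]
  pos' t ht := Real.rpow_pos_of_pos (abs_pos.2 ht.ne') p
  tendsto' := (tendsto_rpow_atTop (by linarith)).comp tendsto_abs_atTop_atTop
  even' t := by simp

end

/-!
The twisted sum is identified with a space of sequences `(zₙ)` in `ℝ²` normed by iterating a single
norm on `ℝ × ℝ²`, and such iterated norms have property (M) for a formal reason.

*Iterated norms.* Let `N` be a norm on `ℝ × V`, `V` finite-dimensional, with `N (a, 0) = |a|` and
`N (-a, v) = N (a, v)`. Put `r₀ = 0`, `rₙ₊₁ = N (rₙ, zₙ)` and `‖z‖ = lim rₙ`. Each step is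
`1`-Lipschitz in its scalar argument. If `u` and `v` are supported below `m` and `(xₙ)` is weakly
null, then after `m` steps the iterations for `u + xₙ` and `v + xₙ` have values close to `‖u‖` and
`‖v‖`, and from there on they process the same tail; so `‖u + xₙ‖ - ‖v + xₙ‖` is asymptotically at
most `|‖u‖ - ‖v‖|`. Property (M) follows when the finitely supported sequences are dense
(`AbsoluteNorm.Space.propertyM`).

*The norm on `ℝ × ℝ²`.* With `ω y = y θ (-log |y|)`, the quasi-norm of the twisted sum is controlled
by the modular `∑ m (xₙ, yₙ)`, `m (x, y) = φ y + φ (x - ω y)`: one has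
`|F y - ω y| ≤ K |log ‖y‖| |y|`, which is harmless because `t log t` is bounded near `0`. The unit
ball of `N` is the convex hull of the set `|a| + A m (z) ≤ 1`. The main point is that
convexification changes `m` only up to constants (`OrliczFunction.twistedModular_sum_le`): if
`φ l = ∑ wᵢ φ (yᵢ)` for a convex combination, then `|∑ wᵢ ω (yᵢ) - ω (∑ wᵢ yᵢ)|` is at most a
constant times `l`, since every logarithm may be compared with `log l`, and the terms with `|yᵢ| > l` satisfy
`|yᵢ| log (|yᵢ| / l) ≤ const · l · φ (yᵢ) / φ l` when `φ` grows near `0` like a power `p > 1`. Hence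
`N (1, z) - 1` is comparable with `m (z)` up to constants and dilations, and summing the increments of the iteration shows that the
iterated norm is equivalent to the quasi-norm.

*Use of type.* Type `p > 1`, tested on disjoint blocks, gives the power growth of `φ`. It also gives
the `Δ₂` condition at `0`, since otherwise `ℓ_φ` contains `ℓ_∞ⁿ`, hence `ℓ_1ᵐ`, uniformly; `Δ₂` yields the
density of `c₀₀ × c₀₀`. For `φ t = |t| ^ p` both properties are immediate.
-/

/-! ### Orlicz functions and the consequences of type -/

namespace OrliczFunction

variable {φ : OrliczFunction}

theorem convexOn_univ (φ : OrliczFunction) : ConvexOn ℝ Set.univ φ.toFun :=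
  ⟨convex_univ, fun s _ t _ _ _ ha hb hab => φ.convex_comb ha hb hab s t⟩

theorem continuous (φ : OrliczFunction) : Continuous φ.toFun :=
  continuousOn_univ.1 (φ.convexOn_univ.continuousOn isOpen_univ)

theorem abs_lt_of_apply_lt {s t : ℝ} (h : φ s < φ t) : |s| < |t| := by
  by_contra! h'
  exact absurd (φ.mono_abs h') (not_le.2 h)

theorem exists_pos_apply_le (φ : OrliczFunction) {ε : ℝ} (hε : 0 < ε) :
    ∃ b : ℝ, 0 < b ∧ φ b ≤ ε := by
  have h : ∀ᶠ t in 𝓝[>] (0 : ℝ), φ t < ε :=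
    (φ.continuous.tendsto 0).mono_left nhdsWithin_le_nhds
      (by rw [φ.map_zero']; exact Iio_mem_nhds hε)
  obtain ⟨b, hb, hb0⟩ := (h.and self_mem_nhdsWithin).exists
  exact ⟨b, hb0, hb.le⟩

theorem radii_mono {x : ℕ → ℝ} {ρ σ : ℝ} (h : ρ ∈ φ.radii x) (hle : ρ ≤ σ) : σ ∈ φ.radii x := by
  obtain ⟨hρ, hs, hs1⟩ := h
  have hle' : ∀ n, φ (x n / σ) ≤ φ (x n / ρ) := fun n => φ.mono_abs <| by
    rw [abs_div, abs_div, abs_of_pos hρ, abs_of_pos (hρ.trans_le hle)]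
    gcongr
  have hs' : Summable fun n => φ (x n / σ) :=
    Summable.of_nonneg_of_le (fun n => φ.nonneg _) hle' hs
  exact ⟨hρ.trans_le hle, hs', (hs'.tsum_le_tsum hle' hs).trans hs1⟩

theorem mem_radii_of_luxNorm_lt {x : ℕ → ℝ} (hx : φ.Mem x) {ρ : ℝ} (h : φ.luxNorm x < ρ) :
    ρ ∈ φ.radii x := by
  obtain ⟨σ, hσ, hlt⟩ := exists_lt_of_csInf_lt (radii_nonempty hx) h
  exact radii_mono hσ hlt.le

theorem luxNorm_le_of_mem_radii {x : ℕ → ℝ} {ρ : ℝ} (h : ρ ∈ φ.radii x) : φ.luxNorm x ≤ ρ :=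
  csInf_le (radii_bddBelow _) h

theorem luxNorm_mono {x y : ℕ → ℝ} (hy : φ.Mem y) (h : ∀ n, |x n| ≤ |y n|) :
    φ.luxNorm x ≤ φ.luxNorm y := by
  refine le_csInf (radii_nonempty hy) fun ρ ⟨hρ, hs, hs1⟩ => luxNorm_le_of_mem_radii ?_
  have hle : ∀ n, φ (x n / ρ) ≤ φ (y n / ρ) := fun n => φ.mono_abs <| by
    rw [abs_div, abs_div]
    exact div_le_div_of_nonneg_right (h n) (abs_nonneg _)
  have hs' : Summable fun n => φ (x n / ρ) :=
    Summable.of_nonneg_of_le (fun n => φ.nonneg _) hle hs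
  exact ⟨hρ, hs', (hs'.tsum_le_tsum hle hs).trans hs1⟩

/-- The modular bounds the norm: by convexity, `∑ φ (xₙ) ≤ M` forces `‖x‖_φ ≤ M` when `M ≥ 1`. -/
theorem luxNorm_le_of_tsum_le {x : ℕ → ℝ} {M : ℝ} (hM : 1 ≤ M) (hs : Summable fun n => φ (x n))
    (h : ∑' n, φ (x n) ≤ M) : φ.luxNorm x ≤ M := by
  have hM0 : 0 < M := by linarith
  have hle : ∀ n, φ (x n / M) ≤ M⁻¹ * φ (x n) := fun n => by
    rw [div_eq_inv_mul]
    exact φ.mul_le (inv_nonneg.2 hM0.le) (inv_le_one_of_one_le₀ hM) _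
  have hs' : Summable fun n => φ (x n / M) :=
    Summable.of_nonneg_of_le (fun n => φ.nonneg _) hle (hs.mul_left _)
  refine luxNorm_le_of_mem_radii ⟨hM0, hs', ?_⟩
  calc ∑' n, φ (x n / M) ≤ ∑' n, M⁻¹ * φ (x n) := hs'.tsum_le_tsum hle (hs.mul_left _)
    _ = M⁻¹ * ∑' n, φ (x n) := tsum_mul_left
    _ ≤ M⁻¹ * M := by gcongr
    _ = 1 := inv_mul_cancel₀ hM0.ne'

theorem mem_of_finite_support {x : ℕ → ℝ} (hx : x.support.Finite) : φ.Mem x := by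
  refine ⟨1, one_pos, summable_of_hasFiniteSupport (hx.subset fun n hn => ?_)⟩
  contrapose! hn
  simp only [Function.mem_support, not_not] at hn ⊢
  simp [hn, φ.map_zero']

theorem mem_of_abs_eq_ite {x : ℕ → ℝ} {M : ℕ} {s : ℝ}
    (h : ∀ j, |x j| = if j < M then s else 0) : φ.Mem x := by
  refine mem_of_finite_support ((Finset.range M).finite_toSet.subset fun j hj => ?_)
  by_contra hj'
  have := h j
  rw [if_neg (by simpa using hj')] at this
  exact hj (abs_eq_zero.1 this)

theorem mem_radii_iff_of_abs_eq_ite {x : ℕ → ℝ} {M : ℕ} {s ρ : ℝ} (hρ : 0 < ρ)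
    (h : ∀ j, |x j| = if j < M then s else 0) : ρ ∈ φ.radii x ↔ M * φ (s / ρ) ≤ 1 := by
  have e : ∀ j, φ (x j / ρ) = if j < M then φ (s / ρ) else 0 := fun j => by
    rw [← φ.apply_abs, abs_div, abs_of_pos hρ, h]
    split_ifs <;> simp [φ.map_zero']
  have hz : ∀ j ∉ Finset.range M, φ (x j / ρ) = 0 := fun j hj => by
    rw [e, if_neg (by simpa using hj)]
  have hsum : ∑' j, φ (x j / ρ) = M * φ (s / ρ) := by
    rw [tsum_eq_sum hz, Finset.sum_congr rfl fun j hj => by rw [e, if_pos (by simpa using hj)]]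
    simp
  have hs : Summable fun j => φ (x j / ρ) := summable_of_ne_finset_zero hz
  simp only [radii, Set.mem_ofPred_eq, hsum, hs, hρ, true_and]

/-- `φ` grows near `0` at least like a power `p > 1`: `φ s ≤ C (s / t) ^ p φ t` for
`0 < s ≤ t ≤ b`. -/
def HasPowerGrowth (φ : OrliczFunction) : Prop :=
  ∃ p C b : ℝ, 1 < p ∧ 0 < b ∧ ∀ s t, 0 < s → s ≤ t → t ≤ b → φ s ≤ C * (s / t) ^ p * φ t

/-- The `Δ₂` condition at `0`. -/
def DeltaTwo (φ : OrliczFunction) : Prop :=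
  ∃ C b : ℝ, 0 < b ∧ ∀ s, |s| ≤ b → φ (2 * s) ≤ C * φ s

end OrliczFunction

namespace OrliczSpace

variable {φ : OrliczFunction}

theorem sum_smul_apply {ι : Type*} (t : Finset ι) (a : ι → ℝ) (x : ι → OrliczSpace φ) (j : ℕ) :
    (∑ i ∈ t, a i • x i).1 j = ∑ i ∈ t, a i * (x i).1 j := by
  have h : (∑ i ∈ t, a i • x i).1 = ∑ i ∈ t, a i • (x i).1 := by
    have := map_sum φ.seqSubmodule.subtype (fun i => (a i • x i : OrliczSpace φ)) t
    exact this
  rw [h, Finset.sum_apply]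
  rfl

end OrliczSpace

theorem abs_intUnit_cast (u : ℤˣ) : |((u : ℤ) : ℝ)| = 1 := by
  rcases Int.units_eq_one_or u with rfl | rfl <;> simp

namespace OrliczFunction

variable {φ : OrliczFunction} {p T : ℝ}

theorem exists_one_le_type_const (h : HasType (OrliczSpace φ) p) :
    ∃ T : ℝ, 1 ≤ T ∧ ∀ (n : ℕ) (x : Fin n → OrliczSpace φ),
      (∑ ε : Fin n → ℤˣ, ‖∑ i, ((ε i : ℤ) : ℝ) • x i‖) / 2 ^ n ≤
        T * (∑ i, ‖x i‖ ^ p) ^ (1 / p) := by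
  obtain ⟨T, hT⟩ := h
  refine ⟨max 1 T, le_max_left _ _, fun n x => (hT n x).trans ?_⟩
  gcongr
  exact le_max_right _ _

theorem sum_rpow_norm_le {n : ℕ} (hp : 0 < p) {x : Fin n → OrliczSpace φ} (hx : ∀ i, ‖x i‖ ≤ 1) :
    (∑ i, ‖x i‖ ^ p) ^ (1 / p) ≤ (n : ℝ) ^ (1 / p) := by
  refine Real.rpow_le_rpow (Finset.sum_nonneg fun i _ => by positivity) ?_ (by positivity)
  calc ∑ i, ‖x i‖ ^ p ≤ ∑ _i : Fin n, (1 : ℝ) :=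
        Finset.sum_le_sum fun i _ => Real.rpow_le_one (norm_nonneg _) (hx i) hp.le
    _ = n := by simp

/-- If every signed sum has norm at least `L`, then so has their average. -/
theorem le_average_of_forall_le {n : ℕ} {L : ℝ} {f : (Fin n → ℤˣ) → ℝ} (h : ∀ ε, L ≤ f ε) :
    L ≤ (∑ ε, f ε) / 2 ^ n := by
  rw [le_div_iff₀ (by positivity)]
  calc L * 2 ^ n = ∑ _ε : Fin n → ℤˣ, L := by simp [mul_comm]
    _ ≤ _ := Finset.sum_le_sum fun ε _ => h ε

/-- Type `p` tested on `n` disjoint blocks of `k` coordinates equal to `t`. -/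
theorem block_estimate_of_type (hp : 0 < p) (hT1 : 1 ≤ T)
    (hT : ∀ (n : ℕ) (x : Fin n → OrliczSpace φ),
      (∑ ε : Fin n → ℤˣ, ‖∑ i, ((ε i : ℤ) : ℝ) • x i‖) / 2 ^ n ≤
        T * (∑ i, ‖x i‖ ^ p) ^ (1 / p))
    {t : ℝ} (ht : 0 < t) {k n : ℕ} (hk : 0 < k) (hn : 0 < n) (hkt : k * φ t ≤ 1) :
    (n * k : ℕ) * φ (t / (2 * T * (n : ℝ) ^ (1 / p))) ≤ 1 := by
  have hn' : (0 : ℝ) < (n : ℝ) ^ (1 / p) := by positivity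
  let f : Fin n → ℕ → ℝ := fun i j => if j / k = i then t else 0
  have hfin : ∀ i, (f i).support.Finite := fun i =>
    (Finset.range (n * k)).finite_toSet.subset fun j hj => by
      have : j / k = i := by
        by_contra h
        exact hj (if_neg h)
      have hlt : j / k < n := this ▸ i.2
      simpa using (Nat.div_lt_iff_lt_mul hk).1 hlt
  let x : Fin n → OrliczSpace φ := fun i => ⟨f i, mem_of_finite_support (hfin i)⟩
  have hblock : ∀ i, ‖x i‖ ≤ 1 := fun i => by
    refine luxNorm_le_of_mem_radii ⟨one_pos, ?_⟩
    have e : ∀ j, φ (f i j / 1) = if j / k = i then φ t else 0 := fun j => by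
      simp only [f, div_one]
      split_ifs <;> simp [φ.map_zero']
    have hz : ∀ j ∉ Finset.Ico (i * k : ℕ) ((i + 1) * k), φ (f i j / 1) = 0 := fun j hj => by
      rw [e, if_neg]
      intro h
      refine hj (Finset.mem_Ico.2 ⟨?_, ?_⟩)
      · exact (Nat.le_div_iff_mul_le hk).1 h.ge
      · exact (Nat.div_lt_iff_lt_mul hk).1 (by omega)
    refine ⟨summable_of_ne_finset_zero hz, ?_⟩
    show ∑' j, φ (f i j / 1) ≤ 1
    rw [tsum_eq_sum hz]
    calc ∑ j ∈ Finset.Ico (i * k : ℕ) ((i + 1) * k), φ (f i j / 1)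
        ≤ ∑ j ∈ Finset.Ico (i * k : ℕ) ((i + 1) * k), φ t := Finset.sum_le_sum fun j _ => by
          rw [e]
          split_ifs
          · exact le_rfl
          · exact φ.nonneg t
      _ = k * φ t := by
          rw [Finset.sum_const, Nat.card_Ico, add_mul, one_mul, Nat.add_sub_cancel_left,
            nsmul_eq_mul]
      _ ≤ 1 := hkt
  have habs : ∀ (ε : Fin n → ℤˣ) (j : ℕ),
      |(∑ i, ((ε i : ℤ) : ℝ) • x i).1 j| = if j < n * k then t else 0 := fun ε j => by
    rw [OrliczSpace.sum_smul_apply]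
    show |∑ i, ((ε i : ℤ) : ℝ) * (if j / k = i then t else 0)| = _
    split_ifs with hj
    · have hlt : j / k < n := (Nat.div_lt_iff_lt_mul hk).2 hj
      rw [Finset.sum_eq_single (⟨j / k, hlt⟩ : Fin n)]
      · rw [if_pos rfl, abs_mul, abs_intUnit_cast, one_mul, abs_of_pos ht]
      · intro i _ hi
        rw [if_neg, mul_zero]
        rintro h
        exact hi (Fin.ext h.symm)
      · simp
    · rw [Finset.sum_eq_zero, abs_zero]
      intro i _
      rw [if_neg, mul_zero]
      rintro h
      have hlt : j / k < n := h ▸ i.2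
      exact hj ((Nat.div_lt_iff_lt_mul hk).1 hlt)
  by_contra! hcon
  have hρ : 0 < 2 * T * (n : ℝ) ^ (1 / p) := by positivity
  have h1 : 2 * T * (n : ℝ) ^ (1 / p) ≤
      (∑ ε : Fin n → ℤˣ, ‖∑ i, ((ε i : ℤ) : ℝ) • x i‖) / 2 ^ n := by
    refine le_average_of_forall_le fun ε => ?_
    by_contra! hlt
    have := (mem_radii_iff_of_abs_eq_ite hρ (habs ε)).1
      (mem_radii_of_luxNorm_lt (∑ i, ((ε i : ℤ) : ℝ) • x i : OrliczSpace φ).2 hlt)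
    linarith
  have h2 := (h1.trans (hT n x)).trans
    (mul_le_mul_of_nonneg_left (sum_rpow_norm_le hp hblock) (by linarith))
  have : 0 < T * (n : ℝ) ^ (1 / p) := by positivity
  linarith

theorem hasPowerGrowth_of_type (hp : 1 < p) (h : HasType (OrliczSpace φ) p) :
    φ.HasPowerGrowth := by
  obtain ⟨T, hT1, hT⟩ := exists_one_le_type_const h
  obtain ⟨b, hb, hb1⟩ := φ.exists_pos_apply_le one_pos
  have hp0 : 0 < p := by linarith
  refine ⟨p, 4 * (2 * T) ^ p, b, hp, hb, fun s t hs hst htb => ?_⟩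
  have ht : 0 < t := hs.trans_le hst
  have hφt : 0 < φ t := φ.pos' t ht
  have hφt1 : φ t ≤ 1 := (φ.monotoneOn' ht.le hb.le htb).trans hb1
  have hT2 : 0 < 2 * T := by linarith
  -- `r` compares the ratio `t / s` with the type constant
  set r : ℝ := t / s / (2 * T) with hr
  have hr0 : 0 < r := by positivity
  have hrp : (2 * T) ^ p * (s / t) ^ p = (r ^ p)⁻¹ := by
    rw [← Real.mul_rpow hT2.le (by positivity), ← Real.inv_rpow hr0.le]
    congr 1
    rw [hr]
    field_simp
  have hrp0 : 0 < r ^ p := by positivity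
  rw [mul_assoc 4, hrp]
  rcases lt_or_ge r 1 with hr1 | hr1
  · have h1 : 1 ≤ (r ^ p)⁻¹ := (one_le_inv₀ hrp0).2 (Real.rpow_le_one hr0.le hr1.le hp0.le)
    have h2 : φ s ≤ φ t := φ.monotoneOn' hs.le ht.le hst
    nlinarith
  set n := ⌊r ^ p⌋₊
  have hrp1 : 1 ≤ r ^ p := Real.one_le_rpow hr1 hp0.le
  have hn1 : 0 < n := Nat.floor_pos.2 hrp1
  have hnle : (n : ℝ) ≤ r ^ p := Nat.floor_le hrp0.le
  have hnlt : r ^ p < n + 1 := Nat.lt_floor_add_one _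
  have hn1' : (1 : ℝ) ≤ n := by exact_mod_cast hn1
  set k := ⌊(φ t)⁻¹⌋₊ with hk
  have hk1 : 0 < k := Nat.floor_pos.2 ((one_le_inv₀ hφt).2 hφt1)
  have hkle : (k : ℝ) ≤ (φ t)⁻¹ := Nat.floor_le (by positivity)
  have hklt : (φ t)⁻¹ < k + 1 := Nat.lt_floor_add_one _
  have hk1' : (1 : ℝ) ≤ k := by exact_mod_cast hk1
  have hkφ : k * φ t ≤ 1 := by
    rwa [← le_div_iff₀ hφt, one_div]
  have hmain := block_estimate_of_type hp0 hT1 hT ht hk1 hn1 hkφ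
  have hroot : (n : ℝ) ^ (1 / p) ≤ r := by
    calc (n : ℝ) ^ (1 / p) ≤ (r ^ p) ^ (1 / p) := by gcongr
      _ = r := by rw [← Real.rpow_mul hr0.le, mul_one_div_cancel hp0.ne', Real.rpow_one]
  have hs_le : s ≤ t / (2 * T * (n : ℝ) ^ (1 / p)) := by
    rw [le_div_iff₀ (by positivity)]
    calc s * (2 * T * (n : ℝ) ^ (1 / p)) ≤ s * (2 * T * r) := by gcongr
      _ = t := by rw [hr]; field_simp
  have hφs : φ s ≤ φ (t / (2 * T * (n : ℝ) ^ (1 / p))) :=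
    φ.monotoneOn' hs.le (hs.le.trans hs_le) hs_le
  have h3 : (n : ℝ) * k * φ s ≤ 1 := by
    push_cast at hmain
    exact (mul_le_mul_of_nonneg_left hφs (by positivity)).trans hmain
  -- `n ≥ r ^ p / 2` and `k ≥ 1 / (2 φ t)`
  have h4 : r ^ p / 2 * ((φ t)⁻¹ / 2) ≤ n * k := by
    gcongr <;> linarith
  have h5 : r ^ p / 2 * ((φ t)⁻¹ / 2) * φ s ≤ 1 :=
    (mul_le_mul_of_nonneg_right h4 (φ.nonneg s)).trans h3
  have h6 : φ s = 4 * (r ^ p)⁻¹ * φ t * (r ^ p / 2 * ((φ t)⁻¹ / 2) * φ s) := by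
    field_simp
    norm_num
  calc φ s = 4 * (r ^ p)⁻¹ * φ t * (r ^ p / 2 * ((φ t)⁻¹ / 2) * φ s) := h6
    _ ≤ 4 * (r ^ p)⁻¹ * φ t * 1 := by gcongr
    _ = _ := mul_one _

/-- Without `Δ₂` the space `ℓ_φ` contains `ℓ_∞ⁿ` uniformly, hence `ℓ_1ᵐ` spanned by the
coordinate functions on the set of sign patterns, which contradicts type `p > 1`. -/
theorem deltaTwo_of_type (hp : 1 < p) (h : HasType (OrliczSpace φ) p) : φ.DeltaTwo := by
  obtain ⟨T, hT1, hT⟩ := exists_one_le_type_const h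
  have hp0 : 0 < p := by linarith
  -- a number of vectors for which type `p` excludes the `ℓ_1` behaviour
  obtain ⟨m, hm1, hm⟩ : ∃ m : ℕ, 0 < m ∧ T * (m : ℝ) ^ (1 / p) < m / 2 := by
    have hpos : 0 < 1 - 1 / p := by
      rw [sub_pos, div_lt_one hp0]; exact hp
    have h1 := ((tendsto_rpow_atTop hpos).comp
      (tendsto_natCast_atTop_atTop (R := ℝ))).eventually_gt_atTop (2 * T)
    obtain ⟨m, hm, hm1⟩ := (h1.and (eventually_gt_atTop 0)).exists
    refine ⟨m, hm1, ?_⟩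
    have hm0 : (0 : ℝ) < m := by exact_mod_cast hm1
    have e : (m : ℝ) = (m : ℝ) ^ (1 / p) * (m : ℝ) ^ (1 - 1 / p) := by
      rw [← Real.rpow_add hm0]; simp
    have h2 : 0 < (m : ℝ) ^ (1 / p) := by positivity
    simp only [Function.comp] at hm
    have h3 : (m : ℝ) ^ (1 / p) * (2 * T) < (m : ℝ) ^ (1 / p) * (m : ℝ) ^ (1 - 1 / p) := by gcongr
    linarith
  obtain ⟨b, hb, hb1⟩ := φ.exists_pos_apply_le one_pos
  set N := Fintype.card (Fin m → ℤˣ)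
  let e : (Fin m → ℤˣ) ≃ Fin N := Fintype.equivFin _
  have hm0 : (0 : ℝ) < m := by exact_mod_cast hm1
  refine ⟨2 * N, b / 2, by positivity, fun t htb => ?_⟩
  rw [← φ.apply_abs t, ← φ.apply_abs (2 * t), abs_mul, abs_two]
  rcases (abs_nonneg t).eq_or_lt with ht0 | hs
  · simp [← ht0, φ.map_zero']
  generalize |t| = s at *
  by_contra! hcon
  have hφ2 : 0 < φ (2 * s) := φ.pos' _ (by positivity)
  have hφ2' : φ (2 * s) ≤ 1 := (φ.mono_abs (by
    rw [abs_of_pos (by positivity), abs_of_pos hb]; linarith)).trans hb1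
  set k := ⌊(φ (2 * s))⁻¹⌋₊ + 1 with hk
  have hk1 : 0 < k := Nat.succ_pos _
  have hklt : 1 < k * φ (2 * s) := by
    rw [← div_lt_iff₀ hφ2, one_div, hk]
    push_cast
    exact Nat.lt_floor_add_one _
  have hkle : (k : ℝ) ≤ 2 * (φ (2 * s))⁻¹ := by
    have h1 : (⌊(φ (2 * s))⁻¹⌋₊ : ℝ) ≤ (φ (2 * s))⁻¹ := Nat.floor_le (by positivity)
    have h2 : 1 ≤ (φ (2 * s))⁻¹ := (one_le_inv₀ hφ2).2 hφ2'
    rw [hk]; push_cast; linarith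
  have hNk : (N * k : ℕ) * φ s ≤ 1 := by
    push_cast
    calc (N : ℝ) * k * φ s ≤ N * (2 * (φ (2 * s))⁻¹) * φ s := by
          gcongr
          exact φ.nonneg s
      _ = (φ (2 * s))⁻¹ * (2 * N * φ s) := by ring
      _ ≤ (φ (2 * s))⁻¹ * φ (2 * s) := by gcongr
      _ = 1 := inv_mul_cancel₀ hφ2.ne'
  let f : Fin m → ℕ → ℝ := fun i j =>
    if hj : j / k < N then (((e.symm ⟨j / k, hj⟩ i : ℤˣ) : ℤ) : ℝ) * s else 0
  have hf : ∀ i j, |f i j| = if j < N * k then s else 0 := fun i j => by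
    simp only [f, ← Nat.div_lt_iff_lt_mul hk1]
    split_ifs
    · rw [abs_mul, abs_intUnit_cast, one_mul, abs_of_pos hs]
    · simp
  let x : Fin m → OrliczSpace φ := fun i => ⟨f i, mem_of_abs_eq_ite (hf i)⟩
  have hx : ∀ i, ‖x i‖ ≤ 1 := fun i =>
    luxNorm_le_of_mem_radii ((mem_radii_iff_of_abs_eq_ite one_pos (hf i)).2 (by simpa using hNk))
  have h1 : (m : ℝ) / 2 ≤ (∑ ε : Fin m → ℤˣ, ‖∑ i, ((ε i : ℤ) : ℝ) • x i‖) / 2 ^ m := by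
    refine le_average_of_forall_le fun ε => ?_
    by_contra! hlt
    -- on the block belonging to `ε` all the signs agree
    obtain ⟨-, hsum, hle⟩ :=
      mem_radii_of_luxNorm_lt (∑ i, ((ε i : ℤ) : ℝ) • x i : OrliczSpace φ).2 hlt
    have hval : ∀ j ∈ Finset.Ico (e ε * k : ℕ) ((e ε + 1) * k),
        (∑ i, ((ε i : ℤ) : ℝ) • x i : OrliczSpace φ).1 j = m * s := fun j hj => by
      obtain ⟨hj1, hj2⟩ := Finset.mem_Ico.1 hj
      have hj3 : j / k = e ε := by
        have h1 := (Nat.le_div_iff_mul_le hk1).2 hj1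
        have h2 := (Nat.div_lt_iff_lt_mul hk1).2 hj2
        omega
      rw [OrliczSpace.sum_smul_apply]
      have : ∀ i, ((ε i : ℤ) : ℝ) * (x i).1 j = s := fun i => by
        show ((ε i : ℤ) : ℝ) * f i j = s
        have hlt : j / k < N := hj3 ▸ (e ε).2
        have he : (⟨j / k, hlt⟩ : Fin N) = e ε := Fin.ext hj3
        simp only [f, dif_pos hlt, he, Equiv.symm_apply_apply]
        rcases Int.units_eq_one_or (ε i) with h | h <;> simp [h]
      rw [Finset.sum_congr rfl fun i _ => this i]
      simp
    have h2 := (hsum.sum_le_tsum (Finset.Ico (e ε * k : ℕ) ((e ε + 1) * k))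
      fun j _ => φ.nonneg _).trans hle
    rw [Finset.sum_congr rfl fun j hj => by
      rw [hval j hj, show (m : ℝ) * s / (m / 2) = 2 * s by field_simp]] at h2
    rw [Finset.sum_const, Nat.card_Ico, add_mul, one_mul, Nat.add_sub_cancel_left,
      nsmul_eq_mul] at h2
    linarith
  have h2 := (h1.trans (hT m x)).trans
    (mul_le_mul_of_nonneg_left (sum_rpow_norm_le hp0 hx) (by linarith))
  linarith

theorem hasPowerGrowth_powOrlicz {p : ℝ} (hp : 1 < p) : (powOrlicz p hp).HasPowerGrowth := by
  refine ⟨p, 1, 1, hp, one_pos, fun s t hs hst _ => le_of_eq ?_⟩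
  have ht : 0 < t := hs.trans_le hst
  show |s| ^ p = 1 * (s / t) ^ p * |t| ^ p
  rw [abs_of_pos hs, abs_of_pos ht, one_mul, ← Real.mul_rpow (by positivity) ht.le,
    div_mul_cancel₀ _ ht.ne']

theorem deltaTwo_powOrlicz {p : ℝ} (hp : 1 < p) : (powOrlicz p hp).DeltaTwo := by
  refine ⟨2 ^ p, 1, one_pos, fun s _ => le_of_eq ?_⟩
  show |2 * s| ^ p = 2 ^ p * |s| ^ p
  rw [abs_mul, abs_two, Real.mul_rpow (by norm_num) (abs_nonneg s)]

end OrliczFunction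

/-! ### Iterated norms and property (M) -/

/-- A norm on `ℝ × V` which is absolute in the scalar coordinate and normalized by
`N (a, 0) = |a|`. -/
structure AbsoluteNorm (V : Type*) [NormedAddCommGroup V] [NormedSpace ℝ V] where
  toSeminorm : Seminorm ℝ (ℝ × V)
  apply_zero' : ∀ a : ℝ, toSeminorm (a, 0) = |a|
  neg_fst' : ∀ (a : ℝ) (v : V), toSeminorm (-a, v) = toSeminorm (a, v)
  eq_zero' : ∀ v : V, toSeminorm (0, v) = 0 → v = 0

namespace AbsoluteNorm

variable {V : Type*} [NormedAddCommGroup V] [NormedSpace ℝ V]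

instance : CoeFun (AbsoluteNorm V) (fun _ => ℝ × V → ℝ) := ⟨fun N => N.toSeminorm⟩

variable (N : AbsoluteNorm V)

theorem add_le (a b : ℝ) (v w : V) : N (a + b, v + w) ≤ N (a, v) + N (b, w) :=
  map_add_le_add N.toSeminorm (a, v) (b, w)

theorem smul_eq (c a : ℝ) (v : V) : N (c * a, c • v) = |c| * N (a, v) :=
  map_smul_eq_mul N.toSeminorm c (a, v)

theorem abs_fst_le (a : ℝ) (v : V) : |a| ≤ N (a, v) := by
  have h1 := N.add_le a a v (-v)
  have h2 : N (a, -v) = N (a, v) := by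
    rw [← N.neg_fst']
    exact map_neg_eq_map N.toSeminorm (a, v)
  rw [add_neg_cancel, N.apply_zero', h2, ← two_mul, abs_mul, abs_two] at h1
  linarith

theorem abs_sub_le (a b : ℝ) (v : V) : |N (a, v) - N (b, v)| ≤ |a - b| := by
  have h := abs_sub_map_le_sub N.toSeminorm (a, v) (b, v)
  simpa [N.apply_zero'] using h

theorem mono {a b : ℝ} (ha : 0 ≤ a) (hab : a ≤ b) (v : V) : N (a, v) ≤ N (b, v) := by
  rcases (ha.trans hab).eq_or_lt with hb | hb
  · obtain rfl : a = b := by linarith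
    exact le_rfl
  -- `(a, v)` lies on the segment between `(b, v)` and `(-b, v)`
  have h := N.add_le ((1 + a / b) / 2 * b) ((1 - a / b) / 2 * -b)
    (((1 + a / b) / 2) • v) (((1 - a / b) / 2) • v)
  have hab1 : a / b ≤ 1 := (div_le_one hb).2 hab
  have h0 : 0 ≤ a / b := by positivity
  rw [N.smul_eq, N.smul_eq, N.neg_fst', ← add_smul, abs_of_nonneg (by linarith),
    abs_of_nonneg (by linarith)] at h
  have e1 : (1 + a / b) / 2 * b + (1 - a / b) / 2 * -b = a := by field_simp; ring
  have e2 : (1 + a / b) / 2 + (1 - a / b) / 2 = 1 := by ring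
  rw [e1, e2, one_smul, ← add_mul, e2, one_mul] at h
  exact h

/-- The iterated norm `rₙ₊₁ = N (rₙ, zₙ)` of a sequence, started at `r₀ = r`. -/
def iter (z : ℕ → V) (r : ℝ) : ℕ → ℝ
  | 0 => r
  | n + 1 => N (iter z r n, z n)

theorem iter_succ (z : ℕ → V) (r : ℝ) (n : ℕ) : N.iter z r (n + 1) = N (N.iter z r n, z n) := rfl

theorem iter_le_succ (z : ℕ → V) (r : ℝ) (n : ℕ) : N.iter z r n ≤ N.iter z r (n + 1) :=
  (le_abs_self _).trans (N.abs_fst_le _ _)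

theorem iter_monotone (z : ℕ → V) (r : ℝ) : Monotone (N.iter z r) :=
  monotone_nat_of_le_succ (N.iter_le_succ z r)

theorem iter_nonneg (z : ℕ → V) {r : ℝ} (hr : 0 ≤ r) (n : ℕ) : 0 ≤ N.iter z r n :=
  hr.trans (N.iter_monotone z r n.zero_le)

theorem abs_iter_sub_le (z : ℕ → V) (r s : ℝ) (n : ℕ) :
    |N.iter z r n - N.iter z s n| ≤ |r - s| := by
  induction n with
  | zero => exact le_rfl
  | succ n ih => exact (N.abs_sub_le _ _ _).trans ih

theorem iter_mono {z : ℕ → V} {r s : ℝ} (hr : 0 ≤ r) (hrs : r ≤ s) (n : ℕ) :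
    N.iter z r n ≤ N.iter z s n := by
  induction n with
  | zero => exact hrs
  | succ n ih => exact N.mono (N.iter_nonneg z hr n) ih _

theorem iter_add_le (z w : ℕ → V) (n : ℕ) :
    N.iter (z + w) 0 n ≤ N.iter z 0 n + N.iter w 0 n := by
  induction n with
  | zero => simp [iter]
  | succ n ih => exact (N.mono (N.iter_nonneg _ le_rfl n) ih _).trans (N.add_le _ _ _ _)

theorem iter_smul (c : ℝ) (z : ℕ → V) (n : ℕ) : N.iter (c • z) 0 n = |c| * N.iter z 0 n := by
  induction n with
  | zero => simp [iter]
  | succ n ih =>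
    rw [iter_succ, iter_succ, ih, ← abs_abs c, ← N.smul_eq, abs_abs]
    rcases abs_choice c with h | h
    · rw [h]; rfl
    · rw [h, Pi.smul_apply, neg_smul, neg_mul, N.neg_fst']
      have := map_neg_eq_map N.toSeminorm (c * N.iter z 0 n, c • z n)
      rw [Prod.neg_mk] at this
      rw [← this, N.neg_fst']

theorem iter_add_index (z : ℕ → V) (r : ℝ) (m n : ℕ) :
    N.iter z r (m + n) = N.iter (fun k => z (m + k)) (N.iter z r m) n := by
  induction n with
  | zero => rfl
  | succ n ih => rw [← add_assoc, iter_succ, iter_succ, ih]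

theorem iter_add_eq_of_forall_ge {z : ℕ → V} {m : ℕ} (h : ∀ k, m ≤ k → z k = 0) (r : ℝ)
    (hr : 0 ≤ r) (n : ℕ) : N.iter z r (m + n) = N.iter z r m := by
  induction n with
  | zero => rfl
  | succ n ih =>
    rw [← add_assoc, iter_succ, h _ (by omega), N.apply_zero', ih,
      abs_of_nonneg (N.iter_nonneg z hr m)]

theorem apply_coord_le_iter (z : ℕ → V) {k n : ℕ} (h : k < n) : N (0, z k) ≤ N.iter z 0 n :=
  (N.mono le_rfl (N.iter_nonneg z le_rfl k) (z k)).trans (N.iter_monotone z 0 h)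

/-- The sequences of finite iterated norm. -/
def seqSubmodule : Submodule ℝ (ℕ → V) where
  carrier := {z | BddAbove (Set.range (N.iter z 0))}
  zero_mem' := by
    refine ⟨0, ?_⟩
    rintro _ ⟨n, rfl⟩
    have := N.iter_smul 0 0 n
    rw [zero_smul, abs_zero, zero_mul] at this
    exact this.le
  add_mem' := by
    rintro z w ⟨a, ha⟩ ⟨b, hb⟩
    refine ⟨a + b, ?_⟩
    rintro _ ⟨n, rfl⟩
    exact (N.iter_add_le z w n).trans (add_le_add (ha ⟨n, rfl⟩) (hb ⟨n, rfl⟩))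
  smul_mem' := by
    rintro c z ⟨a, ha⟩
    refine ⟨|c| * a, ?_⟩
    rintro _ ⟨n, rfl⟩
    rw [N.iter_smul]
    exact mul_le_mul_of_nonneg_left (ha ⟨n, rfl⟩) (abs_nonneg c)

/-- The space of all sequences of finite iterated norm, normed by the limit of the iterated
norms. -/
def Space : Type _ := N.seqSubmodule

noncomputable section

instance : AddCommGroup N.Space := inferInstanceAs (AddCommGroup N.seqSubmodule)
instance : Module ℝ N.Space := inferInstanceAs (Module ℝ N.seqSubmodule)
instance : Norm N.Space := ⟨fun z => ⨆ n, N.iter z.1 0 n⟩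

end

namespace Space

variable {N}

theorem iter_le_norm (z : N.Space) (n : ℕ) : N.iter z.1 0 n ≤ ‖z‖ := le_ciSup z.2 n

theorem norm_le_of_forall {z : N.Space} {C : ℝ} (h : ∀ n, N.iter z.1 0 n ≤ C) : ‖z‖ ≤ C :=
  ciSup_le h

theorem apply_coord_le_norm (z : N.Space) (k : ℕ) : N (0, z.1 k) ≤ ‖z‖ :=
  (N.apply_coord_le_iter z.1 k.lt_succ_self).trans (iter_le_norm z _)

theorem normCore : NormedSpace.Core ℝ N.Space where
  norm_nonneg z := iter_le_norm z 0
  norm_smul c z := by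
    show ⨆ n, N.iter (c • z.1) 0 n = |c| * ⨆ n, N.iter z.1 0 n
    simp only [N.iter_smul, Real.mul_iSup_of_nonneg (abs_nonneg c)]
  norm_triangle z w := norm_le_of_forall fun n =>
    (N.iter_add_le z.1 w.1 n).trans (add_le_add (iter_le_norm z n) (iter_le_norm w n))
  norm_eq_zero_iff z := by
    constructor
    · intro h
      refine Subtype.ext (funext fun k => N.eq_zero' _ (le_antisymm ?_ (apply_nonneg _ _)))
      exact (apply_coord_le_norm z k).trans_eq h
    · rintro rfl
      refine le_antisymm (norm_le_of_forall fun n => ?_) (iter_le_norm 0 0)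
      have := N.iter_smul 0 0 n
      rw [zero_smul, abs_zero, zero_mul] at this
      exact this.le

noncomputable section

instance : NormedAddCommGroup N.Space := NormedAddCommGroup.ofCore normCore
instance : NormedSpace ℝ N.Space := NormedSpace.ofCore normCore

end

/-- The tail of `x` enters both iterations in the same way, and each further step is
`1`-Lipschitz in the starting value; hence only the values after `m` steps matter. -/
theorem norm_add_le_norm_add {u v : N.Space} {m : ℕ} (hu : ∀ k, m ≤ k → u.1 k = 0)
    (hv : ∀ k, m ≤ k → v.1 k = 0) (x : N.Space) :
    ‖u + x‖ ≤ ‖v + x‖ + |N.iter (u.1 + x.1) 0 m - N.iter (v.1 + x.1) 0 m| := by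
  refine norm_le_of_forall fun n => ?_
  have htail : ∀ w : N.Space, (∀ k, m ≤ k → w.1 k = 0) →
      N.iter (w.1 + x.1) 0 (m + n) =
        N.iter (fun k => x.1 (m + k)) (N.iter (w.1 + x.1) 0 m) n := fun w hw => by
    rw [iter_add_index]
    congr 1
    funext k
    simp [hw (m + k) (by omega)]
  have h1 : N.iter (u.1 + x.1) 0 n ≤ N.iter (u.1 + x.1) 0 (m + n) :=
    N.iter_monotone _ _ (by omega)
  have h2 : N.iter (v.1 + x.1) 0 (m + n) ≤ ‖v + x‖ := iter_le_norm (v + x) (m + n)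
  have h3 := N.abs_iter_sub_le (fun k => x.1 (m + k)) (N.iter (u.1 + x.1) 0 m)
    (N.iter (v.1 + x.1) 0 m) n
  rw [← htail u hu, ← htail v hv] at h3
  have h4 := (le_abs_self _).trans h3
  show N.iter (u.1 + x.1) 0 n ≤ _
  linarith

theorem norm_eq_iter_of_forall_ge {u : N.Space} {m : ℕ} (hu : ∀ k, m ≤ k → u.1 k = 0) :
    ‖u‖ = N.iter u.1 0 m := by
  refine le_antisymm (norm_le_of_forall fun n => ?_) (iter_le_norm u m)
  rw [← N.iter_add_eq_of_forall_ge hu 0 le_rfl n]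
  exact N.iter_monotone _ _ (by omega)

end Space

section FiniteDimensional

variable [FiniteDimensional ℝ V]

theorem continuous : Continuous N.toSeminorm :=
  continuousOn_univ.1 (N.toSeminorm.convexOn.continuousOn isOpen_univ)

theorem continuous_iter (r : ℝ) (n : ℕ) : Continuous fun z : ℕ → V => N.iter z r n := by
  induction n with
  | zero => exact continuous_const
  | succ n ih => exact N.continuous.comp (ih.prodMk (continuous_apply n))

theorem exists_mul_norm_le : ∃ c : ℝ, 0 < c ∧ ∀ v : V, c * ‖v‖ ≤ N (0, v) := by
  have hcont : Continuous fun v : V => N (0, v) :=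
    N.continuous.comp (continuous_const.prodMk continuous_id)
  rcases subsingleton_or_nontrivial V with hV | hV
  · exact ⟨1, one_pos, fun v => by rw [Subsingleton.elim v 0]; simp⟩
  obtain ⟨v₀, hv₀, hmin⟩ := (isCompact_sphere (0 : V) 1).exists_isMinOn
    (NormedSpace.sphere_nonempty.2 zero_le_one) hcont.continuousOn
  have hv₀' : ‖v₀‖ = 1 := by simpa using hv₀
  have hpos : 0 < N (0, v₀) := by
    refine lt_of_le_of_ne (apply_nonneg _ _) fun h => ?_
    rw [N.eq_zero' v₀ h.symm, norm_zero] at hv₀'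
    exact zero_ne_one hv₀'
  refine ⟨N (0, v₀), hpos, fun v => ?_⟩
  rcases eq_or_ne v 0 with rfl | hv
  · simp
  have hv' : 0 < ‖v‖ := norm_pos_iff.2 hv
  have h1 : N (0, v₀) ≤ N (0, ‖v‖⁻¹ • v) := hmin (by simp [norm_smul, hv'.ne'])
  have h2 := N.smul_eq ‖v‖⁻¹ 0 v
  rw [mul_zero, abs_of_pos (by positivity)] at h2
  rw [h2, inv_mul_eq_div, le_div_iff₀ hv'] at h1
  exact h1

namespace Space

variable {N}

theorem exists_norm_coord_le : ∃ C : ℝ, 0 < C ∧ ∀ (z : N.Space) (k : ℕ), ‖z.1 k‖ ≤ C * ‖z‖ := by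
  obtain ⟨c, hc, h⟩ := N.exists_mul_norm_le
  refine ⟨c⁻¹, by positivity, fun z k => ?_⟩
  rw [inv_mul_eq_div, le_div_iff₀' hc]
  exact (h _).trans (apply_coord_le_norm z k)

/-- The `k`-th coordinate as a bounded linear map. -/
noncomputable def coordCLM (k : ℕ) : N.Space →L[ℝ] V :=
  LinearMap.mkContinuousOfExistsBound
    { toFun := fun z => z.1 k
      map_add' := fun _ _ => rfl
      map_smul' := fun _ _ => rfl }
    (by
      obtain ⟨C, -, h⟩ := exists_norm_coord_le (N := N)
      exact ⟨C, fun z => h z k⟩)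

instance : CompleteSpace N.Space := by
  refine Metric.complete_of_cauchySeq_tendsto fun u hu => ?_
  have hcoord : ∀ k, ∃ v, Tendsto (fun n => (u n).1 k) atTop (𝓝 v) := fun k =>
    cauchySeq_tendsto_of_complete (hu.map (coordCLM k).uniformContinuous)
  choose z hz using hcoord
  have key : ∀ ε > 0, ∃ M, ∀ m ≥ M, ∀ j, N.iter ((u m).1 - z) 0 j ≤ ε := fun ε hε => by
    obtain ⟨M, hM⟩ := Metric.cauchySeq_iff.1 hu ε hε
    refine ⟨M, fun m hm j => ?_⟩
    have hlim : Tendsto (fun n => (u m).1 - (u n).1) atTop (𝓝 ((u m).1 - z)) :=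
      tendsto_const_nhds.sub (tendsto_pi_nhds.2 hz)
    refine le_of_tendsto (((N.continuous_iter 0 j).tendsto _).comp hlim) ?_
    filter_upwards [eventually_ge_atTop M] with n hn
    refine (iter_le_norm (u m - u n) j).trans ?_
    have := hM m hm n hn
    rw [dist_eq_norm] at this
    exact this.le
  have hmem : ∀ m, (∃ C, ∀ j, N.iter ((u m).1 - z) 0 j ≤ C) → z ∈ N.seqSubmodule := by
    rintro m ⟨C, hC⟩
    have h : (u m).1 - z ∈ N.seqSubmodule := ⟨C, by rintro _ ⟨j, rfl⟩; exact hC j⟩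
    simpa using N.seqSubmodule.sub_mem (u m).2 h
  obtain ⟨M₁, hM₁⟩ := key 1 one_pos
  refine ⟨(⟨z, hmem M₁ ⟨1, hM₁ M₁ le_rfl⟩⟩ : N.Space), Metric.tendsto_atTop.2 fun ε hε => ?_⟩
  obtain ⟨M, hM⟩ := key (ε / 2) (half_pos hε)
  refine ⟨M, fun m hm => ?_⟩
  have h : ‖u m - ⟨z, hmem _ ⟨1, hM₁ M₁ le_rfl⟩⟩‖ ≤ ε / 2 := norm_le_of_forall (hM m hm)
  exact (dist_eq_norm (u m) _).trans_lt (h.trans_lt (half_lt_self hε))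

theorem tendsto_coord_of_weaklyNull {x : ℕ → N.Space}
    (hx : ∀ f : N.Space →L[ℝ] ℝ, Tendsto (fun n => f (x n)) atTop (𝓝 0)) (k : ℕ) :
    Tendsto (fun n => (x n).1 k) atTop (𝓝 0) := by
  let b := Module.finBasis ℝ V
  have h : Tendsto (fun n => ∑ i, b.repr ((x n).1 k) i • b i) atTop
      (𝓝 (∑ i, (0 : ℝ) • b i)) :=
    tendsto_finsetSum _ fun i _ => Tendsto.smul_const
      (hx ((LinearMap.toContinuousLinearMap (b.coord i)).comp (coordCLM k))) (b i)
  simpa only [b.sum_repr, zero_smul, Finset.sum_const_zero] using h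

end Space

end FiniteDimensional

end AbsoluteNorm

/-- Sequences bounded below whose difference tends to `0` have the same `limsup`; no upper bound
is needed, since for unbounded sequences both sides are the same default value. -/
theorem limsup_eq_of_forall_eventually_abs_sub_le {a b : ℕ → ℝ} (ha : ∀ n, 0 ≤ a n)
    (hb : ∀ n, 0 ≤ b n) (h : ∀ ε > 0, ∀ᶠ n in atTop, |a n - b n| ≤ ε) :
    limsup a atTop = limsup b atTop := by
  have hshift : ∀ {a b : ℕ → ℝ}, (∀ ε > 0, ∀ᶠ n in atTop, |a n - b n| ≤ ε) →
      ∀ {c : ℝ}, (∀ᶠ n in atTop, b n ≤ c) → ∀ ε > 0, ∀ᶠ n in atTop, a n ≤ c + ε := by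
    intro a b h c hc ε hε
    filter_upwards [h ε hε, hc] with n h1 h2
    linarith [(abs_le.1 h1).2]
  have hle : ∀ {a b : ℕ → ℝ}, (∀ n, 0 ≤ a n) → (∀ ε > 0, ∀ᶠ n in atTop, |a n - b n| ≤ ε) →
      (∃ c, ∀ᶠ n in atTop, b n ≤ c) → limsup a atTop ≤ limsup b atTop := by
    intro a b ha h hne
    rw [limsup_eq, limsup_eq]
    refine le_csInf hne fun c hc => le_of_forall_pos_le_add fun ε hε =>
      csInf_le ⟨0, fun d hd => ?_⟩ (hshift h hc ε hε)
    obtain ⟨n, hn⟩ := Eventually.exists hd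
    exact (ha n).trans hn
  have h' : ∀ ε > 0, ∀ᶠ n in atTop, |b n - a n| ≤ ε := by simpa only [abs_sub_comm] using h
  by_cases hne : ∃ c, ∀ᶠ n in atTop, b n ≤ c
  · obtain ⟨c, hc⟩ := hne
    exact le_antisymm (hle ha h ⟨c, hc⟩) (hle hb h' ⟨c + 1, hshift h hc 1 one_pos⟩)
  · have hne' : ¬∃ c, ∀ᶠ n in atTop, a n ≤ c := fun ⟨c, hc⟩ =>
      hne ⟨c + 1, hshift h' hc 1 one_pos⟩
    rw [limsup_eq, limsup_eq]
    congr 1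
    ext c
    exact iff_of_false (fun hc => hne' ⟨c, hc⟩) fun hc => hne ⟨c, hc⟩

theorem AbsoluteNorm.Space.propertyM {V : Type*} [NormedAddCommGroup V] [NormedSpace ℝ V]
    [FiniteDimensional ℝ V] {N : AbsoluteNorm V}
    (hd : ∀ (u : N.Space) (ε : ℝ), 0 < ε →
      ∃ (w : N.Space) (m : ℕ), (∀ k, m ≤ k → w.1 k = 0) ∧ ‖u - w‖ ≤ ε) :
    PropertyM N.Space := by
  intro u v x huv hx
  refine limsup_eq_of_forall_eventually_abs_sub_le (fun _ => norm_nonneg _)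
    (fun _ => norm_nonneg _) fun ε hε => ?_
  obtain ⟨u', m₁, hu'0, hu'⟩ := hd u (ε / 6) (by positivity)
  obtain ⟨v', m₂, hv'0, hv'⟩ := hd v (ε / 6) (by positivity)
  set m := max m₁ m₂
  have hu0 : ∀ k, m ≤ k → u'.1 k = 0 := fun k hk => hu'0 k ((le_max_left _ _).trans hk)
  have hv0 : ∀ k, m ≤ k → v'.1 k = 0 := fun k hk => hv'0 k ((le_max_right _ _).trans hk)
  have hlim : ∀ w : N.Space, (∀ k, m ≤ k → w.1 k = 0) →
      Tendsto (fun n => N.iter (w.1 + (x n).1) 0 m) atTop (𝓝 ‖w‖) := fun w hw => by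
    rw [norm_eq_iter_of_forall_ge hw]
    have h : Tendsto (fun n => w.1 + (x n).1) atTop (𝓝 (w.1 + 0)) :=
      tendsto_const_nhds.add (tendsto_pi_nhds.2 fun k => tendsto_coord_of_weaklyNull hx k)
    rw [add_zero] at h
    exact ((N.continuous_iter 0 m).tendsto _).comp h
  have hdiff : |‖u'‖ - ‖v'‖| ≤ ε / 3 := by
    have h1 := abs_norm_sub_norm_le u u'
    have h2 := abs_norm_sub_norm_le v v'
    rw [abs_le] at h1 h2 ⊢
    constructor <;> linarith
  have hev : ∀ᶠ n in atTop,
      |N.iter (u'.1 + (x n).1) 0 m - N.iter (v'.1 + (x n).1) 0 m| < ε / 2 :=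
    (((hlim u' hu0).sub (hlim v' hv0)).abs).eventually_lt_const (by linarith)
  filter_upwards [hev] with n hn
  have h1 := norm_add_le_norm_add hu0 hv0 (x n)
  have h2 := norm_add_le_norm_add hv0 hu0 (x n)
  rw [abs_sub_comm] at h2
  have h3 := abs_norm_sub_norm_le (u + x n) (u' + x n)
  have h4 := abs_norm_sub_norm_le (v + x n) (v' + x n)
  rw [add_sub_add_right_eq_sub] at h3 h4
  rw [abs_le] at h3 h4 ⊢
  constructor <;> linarith

/-! ### Convexification of the twisted modular -/

/-- The quasi-additive function `ω y = y θ (-log |y|)`, the coordinatewise form of `F` on the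
unit sphere. -/
noncomputable def quasiAdditive (θ : ℝ → ℝ) (y : ℝ) : ℝ := y * θ (-Real.log |y|)

section QuasiAdditiveFunction

variable {θ : ℝ → ℝ} {K : ℝ≥0}

theorem quasiAdditive_zero (θ : ℝ → ℝ) : quasiAdditive θ 0 = 0 := by simp [quasiAdditive]

theorem quasiAdditive_neg (θ : ℝ → ℝ) (y : ℝ) : quasiAdditive θ (-y) = -quasiAdditive θ y := by
  simp [quasiAdditive]

theorem abs_quasiAdditive_sub_le (hθ : LipschitzWith K θ) (y a : ℝ) :
    |quasiAdditive θ y - y * θ a| ≤ K * (|y| * |-Real.log |y| - a|) := by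
  rw [quasiAdditive, ← mul_sub, abs_mul]
  calc |y| * |θ (-Real.log |y|) - θ a| ≤ |y| * (K * |-Real.log |y| - a|) := by
        gcongr; exact lip_abs hθ _ _
    _ = _ := by ring

theorem continuousAt_quasiAdditive_zero (hθ : LipschitzWith K θ) :
    ContinuousAt (quasiAdditive θ) 0 := by
  have h1 : Tendsto (fun y : ℝ => K * |y * Real.log y| + |y * θ 0|) (𝓝 0) (𝓝 0) := by
    have h : Continuous fun y : ℝ => K * |y * Real.log y| + |y * θ 0| :=
      (continuous_const.mul Real.continuous_mul_log.abs).add (by fun_prop)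
    simpa using h.tendsto 0
  rw [ContinuousAt, quasiAdditive_zero]
  refine squeeze_zero_norm (fun y => ?_) h1
  have h2 := abs_quasiAdditive_sub_le hθ y 0
  rw [sub_zero, abs_neg, Real.log_abs, ← abs_mul] at h2
  rw [Real.norm_eq_abs]
  have h3 := abs_add_le (quasiAdditive θ y - y * θ 0) (y * θ 0)
  rw [sub_add_cancel] at h3
  linarith

end QuasiAdditiveFunction

namespace OrliczFunction

variable {φ : OrliczFunction}

theorem apply_lt_apply {s t : ℝ} (h : |s| < |t|) : φ s < φ t := by
  have ht : 0 < |t| := (abs_nonneg s).trans_lt h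
  have h1 := φ.mul_le (a := |s| / |t|) (by positivity) ((div_le_one ht).2 h.le) |t|
  rw [div_mul_cancel₀ _ ht.ne', φ.apply_abs, φ.apply_abs] at h1
  have h2 : 0 < φ t := by rw [← φ.apply_abs]; exact φ.pos' _ ht
  calc φ s ≤ |s| / |t| * φ t := h1
    _ < 1 * φ t := by gcongr; rwa [div_lt_one ht]
    _ = φ t := one_mul _

theorem abs_le_of_apply_le {s t : ℝ} (h : φ s ≤ φ t) : |s| ≤ |t| := by
  by_contra! h'
  exact absurd (apply_lt_apply h') (not_lt.2 h)

theorem eq_zero_of_apply_eq_zero {t : ℝ} (h : φ t = 0) : t = 0 := by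
  have := abs_le_of_apply_le (φ := φ) (s := t) (t := 0) (by rw [h, φ.map_zero'])
  simpa using this

theorem exists_apply_eq {b S : ℝ} (hb : 0 ≤ b) (hS : 0 ≤ S) (hSb : S ≤ φ b) :
    ∃ l, 0 ≤ l ∧ l ≤ b ∧ φ l = S := by
  obtain ⟨l, hl, h⟩ := intermediate_value_Icc hb φ.continuous.continuousOn
    (show S ∈ Set.Icc (φ.toFun 0) (φ.toFun b) from ⟨by rwa [φ.map_zero'], hSb⟩)
  exact ⟨l, hl.1, hl.2, h⟩

/-- The form in which power growth enters: `t log (t / l)` is dominated by `l φ t / φ l`. -/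
theorem HasPowerGrowth.exists_log_growth (h : φ.HasPowerGrowth) :
    ∃ E b : ℝ, 0 ≤ E ∧ 0 < b ∧ ∀ l t, 0 < l → l ≤ t → t ≤ b →
      φ l * (t * Real.log (t / l)) ≤ E * l * φ t := by
  obtain ⟨p, C, b, hp, hb, hC⟩ := h
  have hp' : 0 < p - 1 := by linarith
  have hC0 : 0 ≤ C := by
    have := hC b b hb le_rfl le_rfl
    rw [div_self hb.ne', Real.one_rpow, mul_one] at this
    have h2 := φ.pos' b hb
    by_contra! h3
    nlinarith
  refine ⟨C / (p - 1), b, by positivity, hb, fun l t hl hlt htb => ?_⟩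
  have ht : 0 < t := hl.trans_le hlt
  have hr : 0 < t / l := by positivity
  have h1 : Real.log (t / l) ≤ (t / l) ^ (p - 1) / (p - 1) := Real.log_le_rpow_div hr.le hp'
  have h2 : (t / l) ^ p = (t / l) ^ (p - 1) * (t / l) := by
    rw [← Real.rpow_add_one hr.ne']; ring_nf
  have h3 : (l / t) ^ p * (t / l) ^ p = 1 := by
    rw [← Real.mul_rpow (by positivity) hr.le, div_mul_div_comm, mul_comm t l,
      div_self (by positivity), Real.one_rpow]
  calc φ l * (t * Real.log (t / l))
      ≤ (C * (l / t) ^ p * φ t) * (t * ((t / l) ^ (p - 1) / (p - 1))) := by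
        have h4 : 0 ≤ Real.log (t / l) := Real.log_nonneg ((one_le_div hl).2 hlt)
        have h5 := φ.nonneg t
        gcongr
        exact hC l t hl hlt htb
    _ = C / (p - 1) * l * φ t * ((l / t) ^ p * ((t / l) ^ (p - 1) * (t / l))) := by
        field_simp
    _ = C / (p - 1) * l * φ t := by rw [← h2, h3, mul_one]

variable {θ : ℝ → ℝ} {K : ℝ≥0} {E b : ℝ}

/-- Convex combinations almost commute with `ω`: the defect is at most a multiple of the level `l`
with `φ l = ∑ wᵢ φ (yᵢ)`. All logarithms are compared with `log l`; the terms with `|yᵢ| ≤ l`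
contribute at most `l` each, the others are controlled by the growth of `φ`. -/
theorem exists_abs_sum_quasiAdditive_sub_le (hθ : LipschitzWith K θ) (hE : 0 ≤ E) (hb : 0 < b)
    (hg : ∀ l t, 0 < l → l ≤ t → t ≤ b → φ l * (t * Real.log (t / l)) ≤ E * l * φ t)
    {ι : Type*} (s : Finset ι) {w y : ι → ℝ} (hw : ∀ i ∈ s, 0 ≤ w i) (hw1 : ∑ i ∈ s, w i = 1)
    (hy : ∀ i ∈ s, |y i| ≤ b) :
    ∃ l, 0 ≤ l ∧ φ l = ∑ i ∈ s, w i * φ (y i) ∧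
      |∑ i ∈ s, w i * quasiAdditive θ (y i) - quasiAdditive θ (∑ i ∈ s, w i * y i)| ≤
        K * (2 + E) * l := by
  have hS0 : 0 ≤ ∑ i ∈ s, w i * φ (y i) :=
    Finset.sum_nonneg fun i hi => mul_nonneg (hw i hi) (φ.nonneg _)
  have hSb : ∑ i ∈ s, w i * φ (y i) ≤ φ b := by
    calc ∑ i ∈ s, w i * φ (y i) ≤ ∑ i ∈ s, w i * φ b := Finset.sum_le_sum fun i hi =>
          mul_le_mul_of_nonneg_left (φ.mono_abs ((hy i hi).trans (le_abs_self b))) (hw i hi)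
      _ = φ b := by rw [← Finset.sum_mul, hw1, one_mul]
  obtain ⟨l, hl0, -, hl⟩ := exists_apply_eq hb.le hS0 hSb
  refine ⟨l, hl0, hl, ?_⟩
  rcases hl0.eq_or_lt with rfl | hlpos
  · -- all terms with positive weight vanish
    rw [φ.map_zero', eq_comm, Finset.sum_eq_zero_iff_of_nonneg
      fun i hi => mul_nonneg (hw i hi) (φ.nonneg _)] at hl
    have hzero : ∀ i ∈ s, w i = 0 ∨ y i = 0 := fun i hi =>
      (mul_eq_zero.1 (hl i hi)).imp_right eq_zero_of_apply_eq_zero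
    rw [Finset.sum_eq_zero fun i hi => ?_, Finset.sum_eq_zero fun i hi => ?_]
    · simp [quasiAdditive_zero]
    · rcases hzero i hi with h | h <;> simp [h]
    · rcases hzero i hi with h | h <;> simp [h, quasiAdditive_zero]
  have hφl : 0 < φ l := φ.pos' l hlpos
  have hsmall : ∀ t, |t| ≤ l → |quasiAdditive θ t - t * θ (-Real.log l)| ≤ K * l := fun t ht => by
    refine (abs_quasiAdditive_sub_le hθ _ _).trans ?_
    gcongr
    rcases (abs_nonneg t).eq_or_lt with h | h
    · rw [← h, zero_mul]; exact hlpos.le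
    · exact mul_log_ratio_le h ht
  have hterm : ∀ i ∈ s, |quasiAdditive θ (y i) - y i * θ (-Real.log l)| ≤
      K * (l + E * l / φ l * φ (y i)) := fun i hi => by
    have h0 : 0 ≤ E * l / φ l * φ (y i) :=
      mul_nonneg (by positivity) (φ.nonneg _)
    rcases le_total |y i| l with h | h
    · refine (hsmall _ h).trans ?_
      gcongr
      linarith
    · refine (abs_quasiAdditive_sub_le hθ _ _).trans ?_
      gcongr
      have hy0 : 0 < |y i| := hlpos.trans_le h
      have h1 := hg l |y i| hlpos h (hy i hi)
      have h2 : Real.log l ≤ Real.log |y i| := Real.log_le_log hlpos h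
      rw [φ.apply_abs, Real.log_div hy0.ne' hlpos.ne'] at h1
      rw [abs_of_nonpos (show -Real.log |y i| - -Real.log l ≤ 0 by linarith)]
      have h3 : |y i| * -(-Real.log |y i| - -Real.log l) ≤ E * l / φ l * φ (y i) := by
        rw [div_mul_eq_mul_div, le_div_iff₀ hφl]
        calc _ = φ l * (|y i| * (Real.log |y i| - Real.log l)) := by ring
          _ ≤ _ := h1
      linarith
  have hmean : |∑ i ∈ s, w i * y i| ≤ l := by
    have h := φ.convexOn_univ.map_sum_le hw hw1 (fun i _ => Set.mem_univ (y i))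
    simp only [smul_eq_mul] at h
    rw [← abs_of_pos hlpos]
    exact abs_le_of_apply_le (h.trans_eq hl.symm)
  have hsum : |∑ i ∈ s, w i * quasiAdditive θ (y i) - (∑ i ∈ s, w i * y i) * θ (-Real.log l)| ≤
      K * (l + E * l) := by
    rw [Finset.sum_mul, ← Finset.sum_sub_distrib]
    calc _ ≤ ∑ i ∈ s, |w i * quasiAdditive θ (y i) - w i * y i * θ (-Real.log l)| :=
          Finset.abs_sum_le_sum_abs _ _
      _ ≤ ∑ i ∈ s, w i * (K * (l + E * l / φ l * φ (y i))) := Finset.sum_le_sum fun i hi => by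
          rw [mul_assoc, ← mul_sub, abs_mul, abs_of_nonneg (hw i hi)]
          exact mul_le_mul_of_nonneg_left (hterm i hi) (hw i hi)
      _ = K * (l * ∑ i ∈ s, w i + E * l / φ l * ∑ i ∈ s, w i * φ (y i)) := by
          rw [Finset.mul_sum, Finset.mul_sum, ← Finset.sum_add_distrib, Finset.mul_sum]
          exact Finset.sum_congr rfl fun i _ => by ring
      _ = K * (l + E * l) := by rw [hw1, ← hl]; field_simp
  have h1 := hsmall _ hmean
  rw [abs_sub_comm] at h1
  have h2 := abs_sub_le (∑ i ∈ s, w i * quasiAdditive θ (y i))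
    ((∑ i ∈ s, w i * y i) * θ (-Real.log l)) (quasiAdditive θ (∑ i ∈ s, w i * y i))
  calc _ ≤ _ := h2
    _ ≤ K * (l + E * l) + K * l := add_le_add hsum h1
    _ = _ := by ring

/-- The density of the modular `∑ φ (yₙ) + ∑ φ (xₙ - ω yₙ)` of the twisted sum. -/
noncomputable def twistedModular (φ : OrliczFunction) (θ : ℝ → ℝ) (z : ℝ × ℝ) : ℝ :=
  φ z.2 + φ (z.1 - quasiAdditive θ z.2)

theorem twistedModular_nonneg (z : ℝ × ℝ) : 0 ≤ φ.twistedModular θ z :=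
  add_nonneg (φ.nonneg _) (φ.nonneg _)

theorem twistedModular_neg (z : ℝ × ℝ) : φ.twistedModular θ (-z) = φ.twistedModular θ z := by
  show φ (-z.2) + φ (-z.1 - quasiAdditive θ (-z.2)) = φ z.2 + φ (z.1 - quasiAdditive θ z.2)
  rw [quasiAdditive_neg, φ.even', ← φ.even' (z.1 - _)]
  congr 2
  ring

theorem continuousAt_twistedModular_zero (hθ : LipschitzWith K θ) :
    ContinuousAt (φ.twistedModular θ) 0 := by
  have h2 : ContinuousAt (fun z : ℝ × ℝ => quasiAdditive θ z.2) 0 :=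
    ContinuousAt.comp (g := quasiAdditive θ) (f := Prod.snd) (x := (0 : ℝ × ℝ))
      (continuousAt_quasiAdditive_zero hθ) continuousAt_snd
  exact (φ.continuous.continuousAt.comp continuousAt_snd).add
    (φ.continuous.continuousAt.comp (continuousAt_fst.sub h2))

/-- The twisted modular is convex up to a factor `2` and a dilation of its second part. -/
theorem twistedModular_sum_le (hθ : LipschitzWith K θ) (hE : 0 ≤ E) (hb : 0 < b)
    (hg : ∀ l t, 0 < l → l ≤ t → t ≤ b → φ l * (t * Real.log (t / l)) ≤ E * l * φ t)
    {D : ℝ} (hD : 0 < D) (hKD : K * (2 + E) ≤ D)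
    {ι : Type*} (s : Finset ι) {w : ι → ℝ} {z : ι → ℝ × ℝ} (hw : ∀ i ∈ s, 0 ≤ w i)
    (hw1 : ∑ i ∈ s, w i = 1) (hy : ∀ i ∈ s, |(z i).2| ≤ b) :
    φ (∑ i ∈ s, w i * (z i).2) +
        φ ((∑ i ∈ s, w i * (z i).1 - quasiAdditive θ (∑ i ∈ s, w i * (z i).2)) / (1 + D)) ≤
      2 * ∑ i ∈ s, w i * φ.twistedModular θ (z i) := by
  obtain ⟨l, hl0, hl, herr⟩ := exists_abs_sum_quasiAdditive_sub_le hθ hE hb hg s hw hw1 hy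
  set err := ∑ i ∈ s, w i * quasiAdditive θ (z i).2 - quasiAdditive θ (∑ i ∈ s, w i * (z i).2)
  set u : ι → ℝ := fun i => (z i).1 - quasiAdditive θ (z i).2
  have h1 : φ (∑ i ∈ s, w i * (z i).2) ≤ ∑ i ∈ s, w i * φ (z i).2 := by
    simpa only [smul_eq_mul] using
      φ.convexOn_univ.map_sum_le hw hw1 (fun i _ => Set.mem_univ (z i).2)
  have h2 : φ (∑ i ∈ s, w i * u i) ≤ ∑ i ∈ s, w i * φ (u i) := by
    simpa only [smul_eq_mul] using φ.convexOn_univ.map_sum_le hw hw1 (fun i _ => Set.mem_univ (u i))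
  have h3 : φ (err / D) ≤ ∑ i ∈ s, w i * φ (z i).2 := by
    rw [← hl]
    refine φ.mono_abs ?_
    rw [abs_div, abs_of_pos hD, abs_of_nonneg hl0, div_le_iff₀' hD]
    exact herr.trans (mul_le_mul_of_nonneg_right hKD hl0)
  have e : (∑ i ∈ s, w i * (z i).1 - quasiAdditive θ (∑ i ∈ s, w i * (z i).2)) / (1 + D) =
      1 / (1 + D) * (∑ i ∈ s, w i * u i) + D / (1 + D) * (err / D) := by
    have : ∑ i ∈ s, w i * u i =
        ∑ i ∈ s, w i * (z i).1 - ∑ i ∈ s, w i * quasiAdditive θ (z i).2 := by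
      rw [← Finset.sum_sub_distrib]
      exact Finset.sum_congr rfl fun i _ => mul_sub _ _ _
    rw [this]
    simp only [err]
    field_simp
    ring
  have h4 := φ.convex_comb (a := 1 / (1 + D)) (b := D / (1 + D)) (by positivity) (by positivity)
    (by field_simp) (∑ i ∈ s, w i * u i) (err / D)
  rw [← e] at h4
  have h5 : 1 / (1 + D) * φ (∑ i ∈ s, w i * u i) ≤ φ (∑ i ∈ s, w i * u i) :=
    mul_le_of_le_one_left (φ.nonneg _) ((div_le_one (by linarith)).2 (by linarith))
  have h6 : D / (1 + D) * φ (err / D) ≤ φ (err / D) :=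
    mul_le_of_le_one_left (φ.nonneg _) ((div_le_one (by linarith)).2 (by linarith))
  have h7 : ∑ i ∈ s, w i * φ.twistedModular θ (z i) =
      ∑ i ∈ s, w i * φ (z i).2 + ∑ i ∈ s, w i * φ (u i) := by
    rw [← Finset.sum_add_distrib]
    exact Finset.sum_congr rfl fun i _ => mul_add _ _ _
  have h8 : 0 ≤ ∑ i ∈ s, w i * φ (u i) :=
    Finset.sum_nonneg fun i hi => mul_nonneg (hw i hi) (φ.nonneg _)
  rw [h7]
  linarith

/-- The unit ball of the norm on `ℝ × ℝ²` attached to the modular `A · twistedModular`. -/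
def twistedBall (φ : OrliczFunction) (θ : ℝ → ℝ) (A : ℝ) : Set (ℝ × ℝ × ℝ) :=
  convexHull ℝ {v | |v.1| + A * φ.twistedModular θ v.2 ≤ 1}

section Ball

variable {A : ℝ}

theorem subset_twistedBall (a : ℝ) (z : ℝ × ℝ) (h : |a| + A * φ.twistedModular θ z ≤ 1) :
    (a, z) ∈ φ.twistedBall θ A :=
  subset_convexHull ℝ _ h

theorem mk_zero_mem_twistedBall {a : ℝ} (ha : |a| ≤ 1) : (a, 0) ∈ φ.twistedBall θ A :=
  subset_twistedBall a 0 (by simpa [twistedModular, quasiAdditive_zero, φ.map_zero'] using ha)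

theorem neg_mem_twistedBall ⦃v : ℝ × ℝ × ℝ⦄ (hv : v ∈ φ.twistedBall θ A) :
    -v ∈ φ.twistedBall θ A := by
  have h : -{v : ℝ × ℝ × ℝ | |v.1| + A * φ.twistedModular θ v.2 ≤ 1} =
      {v | |v.1| + A * φ.twistedModular θ v.2 ≤ 1} := by
    ext v
    simp [twistedModular_neg]
  rw [twistedBall, ← Set.mem_neg, ← convexHull_neg, h]
  exact hv

theorem neg_fst_mem_twistedBall {a : ℝ} {z : ℝ × ℝ} (hv : (a, z) ∈ φ.twistedBall θ A) :
    (-a, z) ∈ φ.twistedBall θ A := by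
  let L : (ℝ × ℝ × ℝ) →ₗ[ℝ] ℝ × ℝ × ℝ :=
    (-LinearMap.fst ℝ ℝ (ℝ × ℝ)).prod (LinearMap.snd ℝ ℝ (ℝ × ℝ))
  have h : L '' φ.twistedBall θ A ⊆ φ.twistedBall θ A := by
    rw [twistedBall, L.image_convexHull]
    refine convexHull_mono ?_
    rintro _ ⟨v, hv, rfl⟩
    simpa [L] using hv
  exact h ⟨_, hv, rfl⟩

theorem twistedBall_mem_nhds (hθ : LipschitzWith K θ) : φ.twistedBall θ A ∈ 𝓝 0 := by
  have h : ContinuousAt (fun v : ℝ × ℝ × ℝ => |v.1| + A * φ.twistedModular θ v.2) 0 :=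
    continuousAt_fst.abs.add (continuousAt_const.mul
      (ContinuousAt.comp (g := φ.twistedModular θ) (f := Prod.snd) (x := (0 : ℝ × ℝ × ℝ))
        (continuousAt_twistedModular_zero hθ) continuousAt_snd))
  have h0 : |(0 : ℝ × ℝ × ℝ).1| + A * φ.twistedModular θ (0 : ℝ × ℝ × ℝ).2 < 1 := by
    simp [twistedModular, quasiAdditive_zero, φ.map_zero']
  filter_upwards [h.eventually_lt_const h0] with v hv
  exact subset_convexHull ℝ _ hv.le

theorem abs_fst_le_of_mem_twistedBall (hA : 0 ≤ A) {v : ℝ × ℝ × ℝ}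
    (hv : v ∈ φ.twistedBall θ A) : |v.1| ≤ 1 := by
  have h : φ.twistedBall θ A ⊆ {v | v.1 ∈ Set.Icc (-1 : ℝ) 1} := by
    refine convexHull_min (fun v hv => ?_)
      ((convex_Icc (-1 : ℝ) 1).linear_preimage (LinearMap.fst ℝ ℝ (ℝ × ℝ)))
    have h1 := mul_nonneg hA (φ.twistedModular_nonneg (θ := θ) v.2)
    have h2 : |v.1| + A * φ.twistedModular θ v.2 ≤ 1 := hv
    exact abs_le.1 (by linarith)
  exact abs_le.2 (h hv)

/-- Convexification has not enlarged the ball too much. -/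
theorem le_one_of_mem_twistedBall (hθ : LipschitzWith K θ) (hE : 0 ≤ E) (hb : 0 < b)
    (hg : ∀ l t, 0 < l → l ≤ t → t ≤ b → φ l * (t * Real.log (t / l)) ≤ E * l * φ t)
    {D : ℝ} (hD : 0 < D) (hKD : K * (2 + E) ≤ D) (hA : 0 < A) (hAb : 1 ≤ A * φ b)
    {a : ℝ} {z : ℝ × ℝ} (hv : (a, z) ∈ φ.twistedBall θ A) :
    |a| + A / 2 * (φ z.2 + φ ((z.1 - quasiAdditive θ z.2) / (1 + D))) ≤ 1 := by
  obtain ⟨ι, x, w, v, hw, hw1, hmem, hsum⟩ := mem_convexHull_iff_exists_fintype.1 hv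
  replace hmem : ∀ i, |(v i).1| + A * φ.twistedModular θ (v i).2 ≤ 1 := hmem
  have hy : ∀ i ∈ Finset.univ, |(v i).2.2| ≤ b := fun i _ => by
    rw [← abs_of_pos hb]
    refine abs_le_of_apply_le (φ := φ) (le_of_mul_le_mul_left (le_trans ?_ hAb) hA)
    have h1 : A * φ (v i).2.2 ≤ A * φ.twistedModular θ (v i).2 :=
      mul_le_mul_of_nonneg_left (le_add_of_nonneg_right (φ.nonneg _)) hA.le
    linarith [abs_nonneg (v i).1, hmem i]
  have key := twistedModular_sum_le hθ hE hb hg hD hKD Finset.univ (z := fun i => (v i).2)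
    (fun i _ => hw i) hw1 hy
  have ha : ∑ i, w i * (v i).1 = a := by
    simpa [Prod.fst_sum] using congrArg Prod.fst hsum
  have hz1 : ∑ i, w i * (v i).2.1 = z.1 := by
    simpa [Prod.fst_sum, Prod.snd_sum] using congrArg (fun v : ℝ × ℝ × ℝ => v.2.1) hsum
  have hz2 : ∑ i, w i * (v i).2.2 = z.2 := by
    simpa [Prod.fst_sum, Prod.snd_sum] using congrArg (fun v : ℝ × ℝ × ℝ => v.2.2) hsum
  rw [hz1, hz2] at key
  have h1 : |a| ≤ ∑ i, w i * |(v i).1| := by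
    rw [← ha]
    refine (Finset.abs_sum_le_sum_abs _ _).trans_eq (Finset.sum_congr rfl fun i _ => ?_)
    rw [abs_mul, abs_of_nonneg (hw i)]
  have h2 : ∑ i, w i * |(v i).1| + A * ∑ i, w i * φ.twistedModular θ (v i).2 ≤ 1 := by
    rw [Finset.mul_sum, ← Finset.sum_add_distrib, ← hw1]
    refine Finset.sum_le_sum fun i _ => ?_
    calc _ = w i * (|(v i).1| + A * φ.twistedModular θ (v i).2) := by ring
      _ ≤ w i * 1 := mul_le_mul_of_nonneg_left (hmem i) (hw i)
      _ = w i := mul_one _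
  have h3 := mul_le_mul_of_nonneg_left key (show 0 ≤ A / 2 by positivity)
  linarith

end Ball

/-- A norm on `ℝ × ℝ²`, the gauge of `twistedBall`, for which `N (1, z) - 1` is comparable with the
twisted modular near `z = 0`. -/
theorem exists_absoluteNorm (hφ : φ.HasPowerGrowth) (hθ : LipschitzWith K θ) :
    ∃ (N : AbsoluteNorm (ℝ × ℝ)) (A c D : ℝ), 0 < A ∧ 0 < c ∧ 0 < D ∧
      (∀ (s : ℝ) (z : ℝ × ℝ), 1 ≤ s → A * φ.twistedModular θ z ≤ 1 →
        N (s, z) ≤ s + A * φ.twistedModular θ z) ∧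
      ∀ (s : ℝ) (z : ℝ × ℝ), N (s, z) ≤ 2 →
        c * (φ (z.2 / 3) + φ ((z.1 / 3 - quasiAdditive θ (z.2 / 3)) / D)) ≤ N (s, z) - s := by
  obtain ⟨E, b, hE, hb, hg⟩ := hφ.exists_log_growth
  have hφb : 0 < φ b := φ.pos' b hb
  set A : ℝ := (φ b)⁻¹
  have hA : 0 < A := by positivity
  have hAb : 1 ≤ A * φ b := (inv_mul_cancel₀ hφb.ne').ge
  set D : ℝ := 1 + K * (2 + E)
  have hKE : 0 ≤ K * (2 + E) := by positivity
  have hD : 0 < D := by positivity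
  have hconv : Convex ℝ (φ.twistedBall θ A) := convex_convexHull ℝ _
  have habs : Absorbent ℝ (φ.twistedBall θ A) := absorbent_nhds_zero (twistedBall_mem_nhds hθ)
  let P : Seminorm ℝ (ℝ × ℝ × ℝ) :=
    gaugeSeminorm ((balanced_iff_neg_mem hconv).2 neg_mem_twistedBall) hconv habs
  have hPle : ∀ v ∈ φ.twistedBall θ A, P v ≤ 1 := fun v hv => gauge_le_one_of_mem hv
  have hPlt : ∀ v r, P v < r → ∃ ρ, 0 < ρ ∧ ρ < r ∧ ∃ w ∈ φ.twistedBall θ A, ρ • w = v :=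
    fun v r h => exists_lt_of_gauge_lt habs h
  have hPsmul : ∀ (r : ℝ) v, P (r • v) = |r| * P v := fun r v => map_smul_eq_mul P r v
  have hzero : ∀ a : ℝ, P (a, 0) = |a| := fun a => by
    have h1 : P (1, 0) = 1 := by
      refine le_antisymm (hPle _ (mk_zero_mem_twistedBall (by simp))) ?_
      by_contra! hlt
      obtain ⟨ρ, hρ, hρ1, w, hw, he⟩ := hPlt _ _ hlt
      have h2 := abs_fst_le_of_mem_twistedBall hA.le hw
      have h3 : ρ * w.1 = 1 := congrArg Prod.fst he
      nlinarith [le_abs_self w.1]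
    have h2 := hPsmul a (1, 0)
    rw [h1, mul_one] at h2
    simpa using h2
  have hneg_le : ∀ (a : ℝ) (z : ℝ × ℝ), P (-a, z) ≤ P (a, z) := fun a z => by
    refine le_of_forall_gt_imp_ge_of_dense fun r hr => ?_
    obtain ⟨ρ, hρ, hρ1, ⟨a', z'⟩, hw, he⟩ := hPlt _ _ hr
    obtain ⟨rfl, rfl⟩ : ρ * a' = a ∧ ρ • z' = z := Prod.mk.inj he
    have h2 := hPsmul ρ (-a', z')
    rw [Prod.smul_mk, smul_eq_mul, mul_neg, abs_of_pos hρ] at h2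
    rw [h2]
    have h3 := hPle _ (neg_fst_mem_twistedBall hw)
    have h4 := mul_le_mul_of_nonneg_left h3 hρ.le
    linarith
  have hneg : ∀ (a : ℝ) (z : ℝ × ℝ), P (-a, z) = P (a, z) := fun a z =>
    le_antisymm (hneg_le a z) (by simpa using hneg_le (-a) z)
  have hlower : ∀ (s : ℝ) (z : ℝ × ℝ), P (s, z) ≤ 2 →
      3 * A / 2 * (φ (z.2 / 3) + φ ((z.1 / 3 - quasiAdditive θ (z.2 / 3)) / (1 + D))) ≤
        P (s, z) - s := fun s z h2 => by
    rw [le_sub_iff_add_le]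
    refine le_of_forall_gt_imp_ge_of_dense fun r hr => ?_
    obtain ⟨ρ, hρ, hρ1, ⟨a', z'⟩, hw, he⟩ := hPlt _ (min r 3) (lt_min hr (by linarith))
    obtain ⟨rfl, rfl⟩ : ρ * a' = s ∧ ρ • z' = z := Prod.mk.inj he
    have hρ3 : ρ < 3 := hρ1.trans_le (min_le_right _ _)
    have hρr : ρ < r := hρ1.trans_le (min_le_left _ _)
    -- mixing with `(1, 0)` replaces the unknown dilation `ρ` by the fixed dilation `3`
    have hmix := hconv hw (mk_zero_mem_twistedBall (a := 1) (by simp)) (a := ρ / 3)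
      (b := 1 - ρ / 3) (by positivity) (by linarith) (by ring)
    have e : (ρ / 3) • (a', z') + (1 - ρ / 3) • ((1 : ℝ), (0 : ℝ × ℝ)) =
        (ρ / 3 * a' + (1 - ρ / 3), (ρ / 3) • z') := by
      ext <;> simp
    rw [e] at hmix
    have h3 := le_one_of_mem_twistedBall hθ hE hb hg hD (by linarith) hA hAb hmix
    have h4 := le_abs_self (ρ / 3 * a' + (1 - ρ / 3))
    have e1 : ((ρ / 3) • z').1 = (ρ • z').1 / 3 := by
      simp only [Prod.smul_fst, smul_eq_mul]; ring
    have e2 : ((ρ / 3) • z').2 = (ρ • z').2 / 3 := by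
      simp only [Prod.smul_snd, smul_eq_mul]; ring
    rw [e1, e2] at h3
    linarith
  refine ⟨⟨P, hzero, hneg, fun z hz => ?_⟩, A, 3 * A / 2, 1 + D, hA, by positivity,
    by positivity, fun s z hs hz => ?_, hlower⟩
  · have h := hlower 0 z (by rw [hz]; norm_num)
    rw [hz, sub_zero] at h
    have h1 := φ.nonneg (z.2 / 3)
    have h2 := φ.nonneg ((z.1 / 3 - quasiAdditive θ (z.2 / 3)) / (1 + D))
    have h3 : φ (z.2 / 3) + φ ((z.1 / 3 - quasiAdditive θ (z.2 / 3)) / (1 + D)) ≤ 0 := by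
      by_contra! h3
      have : 0 < 3 * A / 2 *
        (φ (z.2 / 3) + φ ((z.1 / 3 - quasiAdditive θ (z.2 / 3)) / (1 + D))) := by positivity
      linarith
    have h4 : z.2 = 0 := by
      have := eq_zero_of_apply_eq_zero (φ := φ) (t := z.2 / 3) (by linarith)
      linarith
    have h5 := eq_zero_of_apply_eq_zero (φ := φ)
      (t := (z.1 / 3 - quasiAdditive θ (z.2 / 3)) / (1 + D)) (by linarith)
    rw [h4, zero_div, quasiAdditive_zero, sub_zero, div_eq_zero_iff] at h5
    have h6 : z.1 = 0 := by
      rcases h5 with h5 | h5 <;> linarith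
    exact Prod.ext h6 h4
  · set m := A * φ.twistedModular θ z with hm
    have hm0 : 0 ≤ m := mul_nonneg hA.le (φ.twistedModular_nonneg _)
    have h1 : P (1 - m, z) ≤ 1 := hPle _ <| subset_twistedBall _ _ <| by
      rw [abs_of_nonneg (by linarith)]; linarith
    have h2 := map_add_le_add P (1 - m, z) (s - 1 + m, 0)
    rw [Prod.mk_add_mk, add_zero, hzero, abs_of_nonneg (by linarith),
      show 1 - m + (s - 1 + m) = s by ring] at h2
    show P (s, z) ≤ s + m
    linarith

end OrliczFunction

/-! ### The twisted sum as a space with an iterated norm -/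

namespace OrliczFunction

variable {φ : OrliczFunction} {θ : ℝ → ℝ} {K : ℝ≥0}

theorem mul_abs_log_le {a M : ℝ} (ha : 0 ≤ a) (haM : a ≤ M) : |Real.log a| * a ≤ 1 + M ^ 2 := by
  rcases ha.eq_or_lt with rfl | ha'
  · simp; positivity
  rcases le_total a 1 with h | h
  · have h1 := mul_log_ratio_le ha' h
    simp only [Real.log_one, neg_zero, sub_zero, abs_neg] at h1
    nlinarith [sq_nonneg M]
  · rw [abs_of_nonneg (Real.log_nonneg h)]
    have h1 := Real.log_le_sub_one_of_pos ha'
    nlinarith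

/-- `F y` and the coordinatewise map `ω y` differ by a multiple of `|y|`, whose factor times
`‖y‖_φ` stays bounded for bounded `‖y‖_φ`. -/
theorem mem_and_luxNorm_quasiLinearF_sub (hθ : LipschitzWith K θ) {y : ℕ → ℝ} (hy : φ.Mem y) :
    φ.Mem (quasiLinearF φ θ y - fun n => quasiAdditive θ (y n)) ∧
      φ.luxNorm (quasiLinearF φ θ y - fun n => quasiAdditive θ (y n)) ≤
        K * (|Real.log (φ.luxNorm y)| * φ.luxNorm y) := by
  set t : ℝ := K * |Real.log (φ.luxNorm y)| with ht
  have ht0 : 0 ≤ t := by positivity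
  have h : ∀ n, |(quasiLinearF φ θ y - fun n => quasiAdditive θ (y n)) n| ≤ |(t • y) n| :=
    fun n => by
      rw [Pi.smul_apply, smul_eq_mul, abs_mul, abs_of_nonneg ht0]
      exact quasiLinearF_sub_le hθ hy n
  have hm := mem_smul t hy
  refine ⟨mem_of_abs_le hm h, (luxNorm_mono hm h).trans_eq ?_⟩
  rw [luxNorm_smul t hy, abs_of_nonneg ht0, ht, mul_assoc]

theorem twistedQuasiNorm_smul (c : ℝ) {hθ : LipschitzWith K θ} {z : (ℕ → ℝ) × (ℕ → ℝ)}
    (hz : z ∈ twistedSum φ hθ) :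
    twistedQuasiNorm φ θ (c • z) = |c| * twistedQuasiNorm φ θ z := by
  simp only [twistedQuasiNorm, Prod.smul_fst, Prod.smul_snd]
  rw [quasiLinearF_smul c hz.1, ← smul_sub, luxNorm_smul c hz.1, luxNorm_smul c hz.2]
  ring

theorem twistedQuasiNorm_nonneg (z : (ℕ → ℝ) × (ℕ → ℝ)) : 0 ≤ twistedQuasiNorm φ θ z :=
  add_nonneg (luxNorm_nonneg _) (luxNorm_nonneg _)

/-- A bound for the modular gives membership in the twisted sum and a bound for the quasi-norm. -/
theorem mem_twistedSum_of_tsum_le (hθ : LipschitzWith K θ) {z : (ℕ → ℝ) × (ℕ → ℝ)} {M D : ℝ}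
    (hM : 1 ≤ M) (hD : 0 < D) (hs : Summable fun n => φ (z.2 n)) (hsM : ∑' n, φ (z.2 n) ≤ M)
    (ht : Summable fun n => φ ((z.1 n - quasiAdditive θ (z.2 n)) / D))
    (htM : ∑' n, φ ((z.1 n - quasiAdditive θ (z.2 n)) / D) ≤ M) :
    z ∈ twistedSum φ hθ ∧ twistedQuasiNorm φ θ z ≤ M + (D * M + K * (1 + M ^ 2)) := by
  have hy : φ.Mem z.2 := ⟨1, one_pos, by simpa only [div_one] using hs⟩
  have hyM : φ.luxNorm z.2 ≤ M := luxNorm_le_of_tsum_le hM hs hsM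
  set v : ℕ → ℝ := fun n => (z.1 n - quasiAdditive θ (z.2 n)) / D with hv
  have hvmem : φ.Mem v := ⟨1, one_pos, by simpa only [div_one] using ht⟩
  have hvM : φ.luxNorm v ≤ M := luxNorm_le_of_tsum_le hM ht htM
  obtain ⟨h1, h2⟩ := mem_and_luxNorm_quasiLinearF_sub (φ := φ) hθ hy
  set f := quasiLinearF φ θ z.2 - fun n => quasiAdditive θ (z.2 n) with hf
  have e : z.1 - quasiLinearF φ θ z.2 = D • v + (-1 : ℝ) • f := by
    funext n
    simp only [hv, hf, Pi.sub_apply, Pi.add_apply, Pi.smul_apply, smul_eq_mul]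
    field_simp
    ring
  have h3 := mem_smul (-1) h1
  have h4 := mem_smul D hvmem
  refine ⟨⟨hy, by rw [e]; exact mem_add h4 h3⟩, ?_⟩
  rw [twistedQuasiNorm, e]
  have h5 := luxNorm_add_le h4 h3
  rw [luxNorm_smul D hvmem, luxNorm_smul _ h1, abs_of_pos hD, abs_neg, abs_one, one_mul] at h5
  have h6 : (K : ℝ) * (|Real.log (φ.luxNorm z.2)| * φ.luxNorm z.2) ≤ K * (1 + M ^ 2) := by
    gcongr
    exact mul_abs_log_le (luxNorm_nonneg _) hyM
  have h7 : D * φ.luxNorm v ≤ D * M := by gcongr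
  linarith

theorem tsum_le_of_luxNorm_lt {x : ℕ → ℝ} (hx : φ.Mem x) {ε : ℝ} (hε : ε ≤ 1)
    (h : φ.luxNorm x < ε) : Summable (fun n => φ (x n)) ∧ ∑' n, φ (x n) ≤ ε := by
  obtain ⟨hε0, hs, hs1⟩ := mem_radii_of_luxNorm_lt hx h
  have hle : ∀ n, φ (x n) ≤ ε * φ (x n / ε) := fun n => by
    have := φ.mul_le hε0.le hε (x n / ε)
    rwa [mul_div_cancel₀ _ hε0.ne'] at this
  have hs' := Summable.of_nonneg_of_le (fun n => φ.nonneg _) hle (hs.mul_left ε)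
  refine ⟨hs', (hs'.tsum_le_tsum hle (hs.mul_left ε)).trans ?_⟩
  rw [tsum_mul_left]
  exact mul_le_of_le_one_right hε0.le hs1

/-- A pair of sequences as a sequence of pairs. -/
def pairSeq (z : (ℕ → ℝ) × (ℕ → ℝ)) : ℕ → ℝ × ℝ := fun n => (z.1 n, z.2 n)

section Equivalence

variable {N : AbsoluteNorm (ℝ × ℝ)}

/-- While the iterated norm is at least `1`, each step increases it by at most `A` times the twisted
modular; these increments sum to at most `1` when the quasi-norm is small. -/
theorem exists_iter_le_two (hθ : LipschitzWith K θ) {A : ℝ} (hA : 0 < A)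
    (hN : ∀ (s : ℝ) (z : ℝ × ℝ), 1 ≤ s → A * φ.twistedModular θ z ≤ 1 →
      N (s, z) ≤ s + A * φ.twistedModular θ z) :
    ∃ η : ℝ, 0 < η ∧ ∀ z ∈ twistedSum φ hθ, twistedQuasiNorm φ θ z ≤ η →
      ∀ n, N.iter (pairSeq z) 0 n ≤ 2 := by
  set ε : ℝ := min 1 (1 / (2 * A)) with hεdef
  have hε : 0 < ε := by positivity
  have hε1 : ε ≤ 1 := min_le_left _ _
  have hεA : A * (ε + ε) ≤ 1 := by
    have h := mul_le_mul_of_nonneg_left (min_le_right 1 (1 / (2 * A))) (by positivity : 0 ≤ 2 * A)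
    rw [mul_one_div_cancel (by positivity)] at h
    linarith
  -- below `η` the correction term `K a |log a|` between `F` and `ω` is small
  obtain ⟨η, hη, hηε, hlog⟩ : ∃ η : ℝ, 0 < η ∧ η < ε / 2 ∧
      ∀ a, 0 ≤ a → a ≤ η → K * (|Real.log a| * a) < ε / 2 := by
    have hc : Continuous fun a : ℝ => K * |a * Real.log a| :=
      continuous_const.mul Real.continuous_mul_log.abs
    have h0 : ∀ᶠ a in 𝓝 (0 : ℝ), K * |a * Real.log a| < ε / 2 :=
      (hc.tendsto 0).eventually_lt_const (by simpa using hε)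
    obtain ⟨r, hr, hr'⟩ := Metric.eventually_nhds_iff.1 h0
    refine ⟨min (r / 2) (ε / 4), by positivity, (min_le_right _ _).trans_lt (by linarith),
      fun a ha haη => ?_⟩
    have h1 : a ≤ r / 2 := haη.trans (min_le_left _ _)
    have h2 := @hr' a (by rw [Real.dist_eq, sub_zero, abs_of_nonneg ha]; linarith)
    rwa [abs_mul, abs_of_nonneg ha, mul_comm a] at h2
  refine ⟨η, hη, fun z hz hzη => ?_⟩
  have ha0 : 0 ≤ φ.luxNorm z.2 := luxNorm_nonneg _
  have hx0 : 0 ≤ φ.luxNorm (z.1 - quasiLinearF φ θ z.2) := luxNorm_nonneg _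
  rw [twistedQuasiNorm] at hzη
  obtain ⟨h1, h2⟩ := mem_and_luxNorm_quasiLinearF_sub (φ := φ) hθ hz.1
  have h3 := hlog (φ.luxNorm z.2) ha0 (by linarith)
  have h4 := luxNorm_add_le hz.2 h1
  have hmem := mem_add hz.2 h1
  rw [sub_add_sub_cancel] at h4 hmem
  obtain ⟨hs, hs'⟩ := tsum_le_of_luxNorm_lt hz.1 hε1 (by linarith)
  obtain ⟨ht, ht'⟩ := tsum_le_of_luxNorm_lt hmem hε1 (by linarith)
  have hsum : ∀ n, ∑ k ∈ Finset.range n, A * φ.twistedModular θ (pairSeq z k) ≤ 1 := fun n => by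
    rw [← Finset.mul_sum]
    refine le_trans (mul_le_mul_of_nonneg_left ?_ hA.le) hεA
    simp only [twistedModular]
    rw [Finset.sum_add_distrib]
    exact add_le_add ((hs.sum_le_tsum _ fun k _ => φ.nonneg _).trans hs')
      ((ht.sum_le_tsum _ fun k _ => φ.nonneg _).trans ht')
  have hnonneg : ∀ k, 0 ≤ A * φ.twistedModular θ (pairSeq z k) := fun k =>
    mul_nonneg hA.le (φ.twistedModular_nonneg _)
  have hiter : ∀ n, N.iter (pairSeq z) 1 n ≤
      1 + ∑ k ∈ Finset.range n, A * φ.twistedModular θ (pairSeq z k) := fun n => by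
    induction n with
    | zero => simp [AbsoluteNorm.iter]
    | succ n ih =>
      have hsingle : A * φ.twistedModular θ (pairSeq z n) ≤ 1 :=
        (Finset.single_le_sum (fun k _ => hnonneg k) (Finset.self_mem_range_succ n)).trans
          (hsum (n + 1))
      have h5 := hN (N.iter (pairSeq z) 1 n) (pairSeq z n)
        (N.iter_monotone _ 1 n.zero_le) hsingle
      rw [AbsoluteNorm.iter_succ, Finset.sum_range_succ]
      linarith
  intro n
  have h5 := N.iter_mono (z := pairSeq z) le_rfl zero_le_one n
  linarith [hiter n, hsum n]

/-- Started at `1`, the iteration stays below `2`, and the sum of its increments bounds the twisted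
modular of `z / 3`. -/
theorem exists_mem_twistedSum_of_iter_le_one (hθ : LipschitzWith K θ) {c D : ℝ} (hc : 0 < c)
    (hD : 0 < D)
    (hN : ∀ (s : ℝ) (z : ℝ × ℝ), N (s, z) ≤ 2 →
      c * (φ (z.2 / 3) + φ ((z.1 / 3 - quasiAdditive θ (z.2 / 3)) / D)) ≤ N (s, z) - s) :
    ∃ C : ℝ, 0 < C ∧ ∀ z, (∀ n, N.iter (pairSeq z) 0 n ≤ 1) →
      z ∈ twistedSum φ hθ ∧ twistedQuasiNorm φ θ z ≤ C := by
  set M : ℝ := max 1 (1 / c)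
  have hM1 : 1 ≤ M := le_max_left _ _
  refine ⟨3 * (M + (D * M + K * (1 + M ^ 2))), by positivity, fun z hz => ?_⟩
  have hiter : ∀ n, N.iter (pairSeq z) 1 n ≤ 2 := fun n => by
    have h1 := (le_abs_self _).trans (N.abs_iter_sub_le (pairSeq z) 1 0 n)
    rw [sub_zero, abs_one] at h1
    linarith [hz n]
  set f : ℕ → ℝ := fun n => φ (z.2 n / 3)
  set g : ℕ → ℝ := fun n => φ ((z.1 n / 3 - quasiAdditive θ (z.2 n / 3)) / D)
  have hf0 : ∀ n, 0 ≤ f n := fun n => φ.nonneg _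
  have hg0 : ∀ n, 0 ≤ g n := fun n => φ.nonneg _
  have htele : ∀ n, ∑ k ∈ Finset.range n, c * (f k + g k) ≤ N.iter (pairSeq z) 1 n - 1 :=
    fun n => by
      induction n with
      | zero => simp [AbsoluteNorm.iter]
      | succ n ih =>
        have h1 : c * (f n + g n) ≤ N.iter (pairSeq z) 1 (n + 1) - N.iter (pairSeq z) 1 n :=
          hN _ (pairSeq z n) (hiter (n + 1))
        rw [Finset.sum_range_succ]
        linarith
  have hfg : ∀ n, ∑ k ∈ Finset.range n, f k + ∑ k ∈ Finset.range n, g k ≤ M := fun n => by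
    have h1 := htele n
    rw [← Finset.mul_sum, Finset.sum_add_distrib] at h1
    refine le_trans ?_ (le_max_right _ _)
    rw [le_div_iff₀' hc]
    linarith [hiter n]
  have hfM : ∀ n, ∑ k ∈ Finset.range n, f k ≤ M := fun n => by
    linarith [hfg n, Finset.sum_nonneg fun k (_ : k ∈ Finset.range n) => hg0 k]
  have hgM : ∀ n, ∑ k ∈ Finset.range n, g k ≤ M := fun n => by
    linarith [hfg n, Finset.sum_nonneg fun k (_ : k ∈ Finset.range n) => hf0 k]
  have e1 : ∀ n, ((3 : ℝ)⁻¹ • z).1 n = z.1 n / 3 := fun n => by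
    simp only [Prod.smul_fst, Pi.smul_apply, smul_eq_mul]; ring
  have e2 : ∀ n, ((3 : ℝ)⁻¹ • z).2 n = z.2 n / 3 := fun n => by
    simp only [Prod.smul_snd, Pi.smul_apply, smul_eq_mul]; ring
  obtain ⟨hmem, hle⟩ := mem_twistedSum_of_tsum_le (φ := φ) (z := (3 : ℝ)⁻¹ • z) hθ hM1 hD
    (by simpa only [e2] using summable_of_sum_range_le hf0 hfM)
    (by simpa only [e2] using Real.tsum_le_of_sum_range_le hf0 hfM)
    (by simpa only [e1, e2] using summable_of_sum_range_le hg0 hgM)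
    (by simpa only [e1, e2] using Real.tsum_le_of_sum_range_le hg0 hgM)
  have e3 : (3 : ℝ) • (3 : ℝ)⁻¹ • z = z := smul_inv_smul₀ (by norm_num) z
  have h1 := twistedQuasiNorm_smul 3 hmem
  rw [e3, abs_of_pos (by norm_num)] at h1
  refine ⟨e3 ▸ (twistedSum φ hθ).smul_mem 3 hmem, ?_⟩
  rw [h1]
  gcongr

theorem exists_iter_le_mul_twistedQuasiNorm (hθ : LipschitzWith K θ)
    (h : ∃ η : ℝ, 0 < η ∧ ∀ z ∈ twistedSum φ hθ, twistedQuasiNorm φ θ z ≤ η →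
      ∀ n, N.iter (pairSeq z) 0 n ≤ 2) :
    ∃ C : ℝ, 0 < C ∧ ∀ z ∈ twistedSum φ hθ, ∀ n,
      N.iter (pairSeq z) 0 n ≤ C * twistedQuasiNorm φ θ z := by
  obtain ⟨η, hη, h⟩ := h
  refine ⟨2 / η, by positivity, fun z hz n => ?_⟩
  have hq := twistedQuasiNorm_nonneg (φ := φ) (θ := θ) z
  set q := twistedQuasiNorm φ θ z with hqdef
  rw [div_mul_eq_mul_div, le_div_iff₀ hη]
  refine le_of_forall_pos_le_add fun ε hε => ?_
  have hqε : 0 < q + ε / 2 := by positivity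
  have ht : 0 < η / (q + ε / 2) := by positivity
  have h1 := h _ ((twistedSum φ hθ).smul_mem (η / (q + ε / 2)) hz) (by
    rw [twistedQuasiNorm_smul _ hz, abs_of_pos ht, ← hqdef, div_mul_eq_mul_div, div_le_iff₀ hqε]
    gcongr
    linarith) n
  have h2 : N.iter (pairSeq ((η / (q + ε / 2)) • z)) 0 n =
      |η / (q + ε / 2)| * N.iter (pairSeq z) 0 n :=
    N.iter_smul _ (pairSeq z) n
  rw [h2, abs_of_pos ht, div_mul_eq_mul_div, div_le_iff₀ hqε] at h1
  linarith

theorem exists_twistedQuasiNorm_le_mul (hθ : LipschitzWith K θ)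
    (h : ∃ C : ℝ, 0 < C ∧ ∀ z, (∀ n, N.iter (pairSeq z) 0 n ≤ 1) →
      z ∈ twistedSum φ hθ ∧ twistedQuasiNorm φ θ z ≤ C) :
    ∃ C : ℝ, 0 < C ∧ ∀ z r, (∀ n, N.iter (pairSeq z) 0 n ≤ r) →
      z ∈ twistedSum φ hθ ∧ twistedQuasiNorm φ θ z ≤ C * r := by
  obtain ⟨C, hC, h⟩ := h
  have key : ∀ z r, 0 < r → (∀ n, N.iter (pairSeq z) 0 n ≤ r) →
      z ∈ twistedSum φ hθ ∧ twistedQuasiNorm φ θ z ≤ C * r := fun z r hr hz => by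
    obtain ⟨h1, h2⟩ := h (r⁻¹ • z) fun n => by
      have h2 : N.iter (pairSeq (r⁻¹ • z)) 0 n = |r⁻¹| * N.iter (pairSeq z) 0 n :=
        N.iter_smul _ (pairSeq z) n
      rw [h2, abs_of_pos (by positivity), inv_mul_le_iff₀ hr, mul_one]
      exact hz n
    have h3 := twistedQuasiNorm_smul r h1
    have e : r • r⁻¹ • z = z := smul_inv_smul₀ hr.ne' z
    rw [e, abs_of_pos hr] at h3
    refine ⟨e ▸ (twistedSum φ hθ).smul_mem r h1, ?_⟩
    rw [h3, mul_comm C]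
    gcongr
  refine ⟨C, hC, fun z r hz => ?_⟩
  have hr : 0 ≤ r := hz 0
  refine ⟨(key z (r + 1) (by linarith) fun n => (hz n).trans (by linarith)).1,
    le_of_forall_pos_le_add fun ε hε => ?_⟩
  have h1 := (key z (r + ε / C) (by positivity) fun n =>
    (hz n).trans (le_add_of_nonneg_right (by positivity))).2
  rwa [mul_add, mul_div_cancel₀ _ hC.ne'] at h1

end Equivalence

section Density

theorem DeltaTwo.summable_two_mul (h : φ.DeltaTwo) {x : ℕ → ℝ}
    (hx : Summable fun n => φ (x n)) : Summable fun n => φ (2 * x n) := by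
  obtain ⟨C, b, hb, hC⟩ := h
  refine Summable.of_norm_bounded_eventually_nat (hx.mul_left C) ?_
  filter_upwards [hx.tendsto_atTop_zero.eventually_lt_const (φ.pos' b hb)] with n hn
  rw [Real.norm_of_nonneg (φ.nonneg _)]
  have := abs_lt_of_apply_lt hn
  rw [abs_of_pos hb] at this
  exact hC _ this.le

/-- Under `Δ₂` the modular of a member of `ℓ_φ` is finite at every scale. -/
theorem DeltaTwo.summable_div (h : φ.DeltaTwo) {y : ℕ → ℝ} (hy : φ.Mem y) {δ : ℝ} (hδ : 0 < δ) :
    Summable fun n => φ (y n / δ) := by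
  obtain ⟨ρ, hρ, hs⟩ := hy
  obtain ⟨k, hk⟩ := pow_unbounded_of_one_lt (ρ / δ) one_lt_two
  have hpow : ∀ k : ℕ, Summable fun n => φ (2 ^ k * (y n / ρ)) := fun k => by
    induction k with
    | zero => simpa using hs
    | succ k ih =>
      simpa only [pow_succ', mul_assoc] using h.summable_two_mul ih
  refine Summable.of_nonneg_of_le (fun n => φ.nonneg _) (fun n => φ.mono_abs ?_) (hpow k)
  have e : y n / δ = ρ / δ * (y n / ρ) := by field_simp
  rw [e, abs_mul, abs_mul, abs_of_pos (by positivity : 0 < ρ / δ),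
    abs_of_pos (by positivity : (0 : ℝ) < 2 ^ k)]
  gcongr

/-- The tail of a sequence from the index `m` on. -/
def tail (m : ℕ) (y : ℕ → ℝ) : ℕ → ℝ := fun n => if m ≤ n then y n else 0

theorem abs_tail_le (m : ℕ) (y : ℕ → ℝ) (n : ℕ) : |tail m y n| ≤ |y n| := by
  unfold tail
  split_ifs <;> simp

theorem mem_tail {y : ℕ → ℝ} (hy : φ.Mem y) (m : ℕ) : φ.Mem (tail m y) :=
  mem_of_abs_le hy (abs_tail_le m y)

theorem DeltaTwo.tendsto_luxNorm_tail (h : φ.DeltaTwo) {y : ℕ → ℝ} (hy : φ.Mem y) :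
    Tendsto (fun m => φ.luxNorm (tail m y)) atTop (𝓝 0) := by
  refine Metric.tendsto_atTop.2 fun ε hε => ?_
  have hs := h.summable_div hy (half_pos hε)
  obtain ⟨M, hM⟩ := eventually_atTop.1
    ((tendsto_sum_nat_add fun n => φ (y n / (ε / 2))).eventually_lt_const one_pos)
  refine ⟨M, fun m hm => ?_⟩
  rw [Real.dist_eq, sub_zero, abs_of_nonneg (luxNorm_nonneg _)]
  refine lt_of_le_of_lt (luxNorm_le_of_mem_radii ?_) (half_lt_self hε)
  have hs' : Summable fun n => φ (tail m y n / (ε / 2)) :=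
    Summable.of_nonneg_of_le (fun n => φ.nonneg _) (fun n => φ.mono_abs (by
      rw [abs_div, abs_div (y n)]
      exact div_le_div_of_nonneg_right (abs_tail_le m y n) (abs_nonneg _))) hs
  refine ⟨half_pos hε, hs', ?_⟩
  rw [← hs'.sum_add_tsum_nat_add m, Finset.sum_eq_zero fun n hn => ?_, zero_add]
  · refine le_trans (le_of_eq (tsum_congr fun n => ?_)) (hM m hm).le
    rw [tail, if_pos (by omega)]
  · rw [tail, if_neg (by simpa using hn), zero_div, φ.map_zero']

theorem DeltaTwo.tendsto_twistedQuasiNorm_tail (h : φ.DeltaTwo) (hθ : LipschitzWith K θ)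
    {z : (ℕ → ℝ) × (ℕ → ℝ)} (hz : z ∈ twistedSum φ hθ) :
    Tendsto (fun m => twistedQuasiNorm φ θ (tail m z.1, tail m z.2)) atTop (𝓝 0) := by
  have h1 := h.tendsto_luxNorm_tail hz.1
  have h2 := h.tendsto_luxNorm_tail hz.2
  set a := φ.luxNorm z.2
  have h3 : Tendsto (fun m => K * (|Real.log a| * φ.luxNorm (tail m z.2) +
      |φ.luxNorm (tail m z.2) * Real.log (φ.luxNorm (tail m z.2))|)) atTop (𝓝 0) := by
    have hc : Continuous fun t : ℝ => K * (|Real.log a| * t + |t * Real.log t|) :=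
      continuous_const.mul ((continuous_const.mul continuous_id).add
        Real.continuous_mul_log.abs)
    have h0 := (hc.tendsto 0).comp h1
    rw [mul_zero, zero_mul, abs_zero, add_zero, mul_zero] at h0
    exact h0
  have hlim := h1.add (h2.add h3)
  simp only [add_zero] at hlim
  refine squeeze_zero (fun m => twistedQuasiNorm_nonneg _) (fun m => ?_) hlim
  set y' := tail m z.2
  set a' := φ.luxNorm y'
  have hy' : φ.Mem y' := mem_tail hz.1 m
  have ha' : 0 ≤ a' := luxNorm_nonneg _
  -- the defect `F (tail) - tail (F)` only sees the change of the norm inside the logarithm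
  set g : ℕ → ℝ := tail m (quasiLinearF φ θ z.2) - quasiLinearF φ θ y' with hg
  set t : ℝ := K * |Real.log a - Real.log a'|
  have ht : 0 ≤ t := by positivity
  have hgle : ∀ n, |g n| ≤ |(t • y') n| := fun n => by
    rw [Pi.smul_apply, smul_eq_mul, abs_mul, abs_of_nonneg ht, hg, Pi.sub_apply]
    by_cases hn : m ≤ n
    · have hyn : y' n = z.2 n := if_pos hn
      rw [tail, if_pos hn, quasiLinearF, quasiLinearF, hyn, ← mul_sub, abs_mul]
      rcases eq_or_ne (z.2 n) 0 with h0 | h0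
      · simp [h0]
      have hapos : 0 < a := luxNorm_pos hz.1 h0
      have hapos' : 0 < a' := luxNorm_pos hy' (n := n) (by rwa [hyn])
      have h4 := lip_abs hθ (Real.log (a / |z.2 n|)) (Real.log (a' / |z.2 n|))
      rw [Real.log_div hapos.ne' (abs_ne_zero.2 h0), Real.log_div hapos'.ne' (abs_ne_zero.2 h0),
        sub_sub_sub_cancel_right] at h4
      rw [Real.log_div hapos.ne' (abs_ne_zero.2 h0), Real.log_div hapos'.ne' (abs_ne_zero.2 h0),
        mul_comm t]
      exact mul_le_mul_of_nonneg_left h4 (abs_nonneg _)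
    · have hyn : y' n = 0 := if_neg hn
      rw [tail, if_neg hn, quasiLinearF, hyn]
      simp
  have hgmem : φ.Mem g := mem_of_abs_le (mem_smul t hy') hgle
  have hgnorm : φ.luxNorm g ≤ t * a' := by
    refine (luxNorm_mono (mem_smul t hy') hgle).trans_eq ?_
    rw [luxNorm_smul t hy', abs_of_nonneg ht]
  have e : tail m z.1 - quasiLinearF φ θ y' = tail m (z.1 - quasiLinearF φ θ z.2) + g := by
    funext n
    simp only [hg, Pi.sub_apply, Pi.add_apply]
    unfold tail
    split_ifs <;> simp
  have h5 := luxNorm_add_le (mem_tail hz.2 m) hgmem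
  rw [← e] at h5
  have h6 : t * a' ≤ K * (|Real.log a| * a' + |a' * Real.log a'|) := by
    rw [abs_mul, abs_of_nonneg ha', mul_comm a' |_|, ← add_mul, ← mul_assoc]
    exact mul_le_mul_of_nonneg_right
      (mul_le_mul_of_nonneg_left (abs_sub _ _) K.2) ha'
  show a' + φ.luxNorm (tail m z.1 - quasiLinearF φ θ y') ≤ _
  linarith

/-- The initial segment of a sequence below the index `m`. -/
def init (m : ℕ) (y : ℕ → ℝ) : ℕ → ℝ := fun n => if m ≤ n then 0 else y n

theorem sub_init (m : ℕ) (y : ℕ → ℝ) : y - init m y = tail m y := by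
  funext n
  rw [Pi.sub_apply, init, tail]
  split_ifs <;> simp

theorem init_support_finite (m : ℕ) (y : ℕ → ℝ) : (init m y).support.Finite :=
  (Finset.range m).finite_toSet.subset fun n hn => by
    by_contra h
    exact hn (if_pos (by simpa using h))

theorem mem_twistedSum_of_finite_support (hθ : LipschitzWith K θ) {w : (ℕ → ℝ) × (ℕ → ℝ)}
    (h1 : w.1.support.Finite) (h2 : w.2.support.Finite) : w ∈ twistedSum φ hθ := by
  refine ⟨mem_of_finite_support h2, mem_of_finite_support ((h1.union h2).subset fun n hn => ?_)⟩
  by_contra h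
  simp only [Set.mem_union, Function.mem_support, not_or, not_not] at h
  exact hn (by simp [quasiLinearF, h.1, h.2])

theorem DeltaTwo.exists_twistedQuasiNorm_sub_init_lt (h : φ.DeltaTwo) (hθ : LipschitzWith K θ)
    {z : (ℕ → ℝ) × (ℕ → ℝ)} (hz : z ∈ twistedSum φ hθ) {δ : ℝ} (hδ : 0 < δ) :
    ∃ m, twistedQuasiNorm φ θ (z - (init m z.1, init m z.2)) < δ := by
  obtain ⟨m, hm⟩ := ((h.tendsto_twistedQuasiNorm_tail hθ hz).eventually_lt_const hδ).exists
  refine ⟨m, ?_⟩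
  rwa [← sub_init, ← sub_init] at hm

theorem DeltaTwo.finiteSupportDense (h : φ.DeltaTwo) (hθ : LipschitzWith K θ) :
    FiniteSupportDense φ hθ := by
  refine ⟨fun w h1 h2 => mem_twistedSum_of_finite_support hθ h1 h2, fun z hz δ hδ => ?_⟩
  obtain ⟨m, hm⟩ := h.exists_twistedQuasiNorm_sub_init_lt hθ hz hδ
  exact ⟨_, mem_twistedSum_of_finite_support hθ (init_support_finite m _)
    (init_support_finite m _), init_support_finite m _, init_support_finite m _, hm⟩

end Density

/-- The Banach space is that of the iterated norm on sequences in `ℝ²`; the isomorphism reads a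
sequence of pairs as a pair of sequences. -/
theorem renormablePropertyM (hφ : φ.HasPowerGrowth) (hΔ : φ.DeltaTwo) (hθ : LipschitzWith K θ) :
    RenormablePropertyM φ hθ := by
  obtain ⟨N, A, c, D, hA, hc, hD, hupper, hlower⟩ := exists_absoluteNorm hφ hθ
  obtain ⟨C₁, hC₁, h₁⟩ := exists_iter_le_mul_twistedQuasiNorm hθ
    (exists_iter_le_two hθ hA hupper)
  obtain ⟨C₂, hC₂, h₂⟩ := exists_twistedQuasiNorm_le_mul hθ
    (exists_mem_twistedSum_of_iter_le_one hθ hc hD hlower)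
  let e : N.Space ≃ₗ[ℝ] twistedSum φ hθ :=
    { toFun := fun v => ⟨(fun n => (v.1 n).1, fun n => (v.1 n).2),
        (h₂ (fun n => (v.1 n).1, fun n => (v.1 n).2) ‖v‖
          (AbsoluteNorm.Space.iter_le_norm v)).1⟩
      map_add' := fun _ _ => rfl
      map_smul' := fun _ _ => rfl
      invFun := fun z => ⟨pairSeq z.1, C₁ * twistedQuasiNorm φ θ z.1, by
        rintro _ ⟨n, rfl⟩
        exact h₁ z.1 z.2 n⟩
      left_inv := fun _ => rfl
      right_inv := fun _ => rfl }
  have hup : ∀ v, ‖v‖ ≤ C₁ * twistedQuasiNorm φ θ (e v) := fun v =>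
    AbsoluteNorm.Space.norm_le_of_forall (h₁ (e v).1 (e v).2)
  refine ⟨N.Space, inferInstance, inferInstance, e, inferInstance,
    ⟨C₂⁻¹, C₁, by positivity, hC₁, fun v => ⟨?_, hup v⟩⟩, ?_⟩
  · rw [inv_mul_le_iff₀ hC₂]
    exact (h₂ (e v).1 ‖v‖ (AbsoluteNorm.Space.iter_le_norm v)).2
  · refine AbsoluteNorm.Space.propertyM fun u ε hε => ?_
    obtain ⟨m, hm⟩ := hΔ.exists_twistedQuasiNorm_sub_init_lt hθ (e u).2
      (show 0 < ε / C₁ by positivity)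
    let w : twistedSum φ hθ := ⟨(init m (e u).1.1, init m (e u).1.2),
      mem_twistedSum_of_finite_support hθ (init_support_finite m _) (init_support_finite m _)⟩
    refine ⟨e.symm w, m, fun k hk => ?_, ?_⟩
    · show (init m (e u).1.1 k, init m (e u).1.2 k) = 0
      rw [init, init, if_pos hk, if_pos hk]
      rfl
    · refine (hup _).trans ?_
      rw [map_sub, e.apply_symm_apply]
      rw [lt_div_iff₀' hC₁] at hm
      exact hm.le

end OrliczFunction

theorem mainTheorem3 :
    (∀ φ : OrliczFunction, HasNontrivialType (OrliczSpace φ) →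
      ∀ (θ : ℝ → ℝ) (K : ℝ≥0) (hθ : LipschitzWith K θ),
        FiniteSupportDense φ hθ ∧ RenormablePropertyM φ hθ) ∧
    -- the Kalton-Peck spaces `Z_p`: the Orlicz function `|t| ^ p` and the identity map
    (∀ (p : ℝ) (hp : 1 < p),
      FiniteSupportDense (powOrlicz p hp) (LipschitzWith.id (α := ℝ)) ∧
        RenormablePropertyM (powOrlicz p hp) (LipschitzWith.id (α := ℝ))) := by
  refine ⟨fun φ ⟨p, hp, _, h⟩ θ K hθ => ?_, fun p hp => ?_⟩
  · have hΔ := OrliczFunction.deltaTwo_of_type hp h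
    exact ⟨hΔ.finiteSupportDense hθ, OrliczFunction.renormablePropertyM
      (OrliczFunction.hasPowerGrowth_of_type hp h) hΔ hθ⟩
  · have hΔ := OrliczFunction.deltaTwo_powOrlicz hp
    exact ⟨hΔ.finiteSupportDense _, OrliczFunction.renormablePropertyM
      (OrliczFunction.hasPowerGrowth_powOrlicz hp) hΔ _⟩
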